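/- Let $X$ be a connected compact (boundaryless) $n$-dimensional Riemannian manifold, $x_0\in X$, $\Gamma=\pi_1(X,x_0)$, and let $\rho\colon\Gamma\to \mathrm{GL}(V)$ be a representation on a finite-dimensional real vector space $V$ that is unimodular, i.e. $|\det\rho(\gamma)|=1$ for all $\gamma\in\Gamma$. Let $E$ be the associated flat vector bundle over $X$, let $h$ be a smooth fibre metric in $E$, and let $M\subset V$ be a $\Gamma$-invariant lattice. Let $K$ be a smooth triangulation of $X$, let $C^*(K;V)$ and $C^*(K;M)$ be the twisted simplicial cochain complexes, with coboundary operators $d$, and let $H^*(X,V)$, $H^*(X,M)$ be their cohomology. By the Hodge–de Rham isomorphism (integration over the simplices of $K$) between the space of $E$-valued harmonic $q$-forms and $H^q(X,V)$, the $L^2$ inner product of harmonic forms, formed with the Riemannian metric and $h$, induces an inner product $\langle\cdot,\cdot\rangle_q$ on $H^q(X,V)$; let $\mu_q$ be the corresponding volume on $H^q(X,V)$. Let $\theta$ be a volume element of $V$, given by a basis $(e_k)$ of $V$. Together with a choice of lifts of the simplices of $K$ to the universal covering it gives preferred bases $\omega_q=(\sigma_j\otimes e_k)_{j,k}$ of $C^q(K;V)$.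 The Reidemeister torsion is $$\tau_X(\rho,h)=\prod_{q=0}^n\left(\frac{\bigl|[\,b^q,\tilde h^q,\tilde b^{q+1}/\omega_q\,]\bigr|}{\operatorname{vol}_{\mu_q}(h^q)}\right)^{(-1)^{q+1}},$$ where $b^q$ is a basis of $dC^{q-1}(K;V)$ (empty for $q=0$), $\tilde b^{q+1}$ is a family in $C^q(K;V)$ mapped by $d$ to $b^{q+1}$, $\tilde h^q$ is a family of cocycles representing a basis $h^q$ of $H^q(X,V)$, and $[\,\cdot/\omega_q]$ is the determinant of the change of basis. Assume that $\theta$ has volume one on $M$ (i.e. $\theta=\pm m_1\wedge\dots\wedge m_r$ for a $\mathbb Z$-basis $m_1,\dots,m_r$ of $M$), or that the Euler characteristic of $X$ vanishes. Identify $H^q(X,M)_{\mathrm{free}}=H^q(X,M)/H^q(X,M)_{\mathrm{tors}}$ with a subgroup of $H^q(X,V)$ and let $R(\rho,h)=\prod_{q=0}^n\sqrt{|\det G_q|}^{\,(-1)^q}$, where $G_q$ is the Gram matrix of a $\mathbb Z$-basis of $H^q(X,M)_{\mathrm{free}}$ with respect to $\langle\cdot,\cdot\rangle_q$. Then, for all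 these choices, $$\tau_X(\rho,h)=R(\rho,h)\cdot\prod_{q=0}^n\bigl|H^q(X,M)_{\mathrm{tors}}\bigr|^{(-1)^{q+1}}.$$ -/

import Mathlib

open Set Topology MeasureTheory
open scoped Manifold ContDiff

namespace Reidemeister

noncomputable section

/-! ### Cochain complexes, their cohomology, and Reidemeister torsion -/

section Algebra

variable {R : Type*} [CommRing R] {C : ℕ → Type*} [∀ q, AddCommGroup (C q)]
  [∀ q, Module R (C q)]

/-- The coboundaries `B^q = d (C^{q-1})`, with `B^0 = 0`. -/
def coboundaries (d : ∀ q, C q →ₗ[R] C (q + 1)) : ∀ q, Submodule R (C q)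
  | 0 => ⊥
  | q + 1 => LinearMap.range (d q)

/-- The cocycles `Z^q = ker d_q`. -/
abbrev cocycles (d : ∀ q, C q →ₗ[R] C (q + 1)) (q : ℕ) : Submodule R (C q) :=
  LinearMap.ker (d q)

/-- The cohomology `H^q = Z^q / B^q`. -/
abbrev Coh (d : ∀ q, C q →ₗ[R] C (q + 1)) (q : ℕ) : Type _ :=
  cocycles d q ⧸ (coboundaries d q).submoduleOf (cocycles d q)

/-- The class of a cocycle. -/
abbrev cohClass (d : ∀ q, C q →ₗ[R] C (q + 1)) (q : ℕ) (z : cocycles d q) : Coh d q :=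
  Submodule.Quotient.mk z

/-- The volume of the parallelepiped spanned by a family `v` with respect to the basis `c`: with `A`
the matrix of coordinates of `v` in `c` this is `√ det (A Aᵀ)`. If `v` has as many members as
`c` it is `|det A|`, the absolute value of the determinant of the change of basis. -/
def relVol {W I J : Type*} [AddCommGroup W] [Module ℝ W] [Fintype I] [Fintype J] [DecidableEq J]
    (c : Module.Basis I ℝ W) (v : J → W) : ℝ :=
  let A : Matrix J I ℝ := Matrix.of fun j i => c.repr (v j) i
  √ (A * A.transpose).det

/-- The volume of a family `v` with respect to a (bilinear) form `B`: the square root of the absolute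
value of the determinant of the Gram matrix. -/
def gramVol {W J : Type*} [Fintype J] [DecidableEq J] (B : W → W → ℝ) (v : J → W) : ℝ :=
  √ |(Matrix.of fun k l => B (v k) (v l)).det|

end Algebra

section Torsion

variable {C : ℕ → Type*} [∀ q, AddCommGroup (C q)] [∀ q, Module ℝ (C q)]
  [∀ q, FiniteDimensional ℝ (C q)]

/-- A basis of `C^q` adapted to `d`: a basis `b^q` of `B^q`, then cocycles representing a basis
`h^q` of `H^q`, then elements mapped by `d` to the chosen basis `b^{q+1}` of `B^{q+1}`. -/
def adaptedBasis (d : ∀ q, C q →ₗ[ℝ] C (q + 1)) (q : ℕ) :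
    Fin (Module.finrank ℝ (coboundaries d q)) ⊕
      (Fin (Module.finrank ℝ (Coh d q)) ⊕
        Fin (Module.finrank ℝ (coboundaries d (q + 1)))) → C q :=
  Sum.elim (fun i => (Module.finBasis ℝ (coboundaries d q) i : C q))
    (Sum.elim
      (fun i => ((Quotient.out (Module.finBasis ℝ (Coh d q) i) : cocycles d q) : C q))
      (fun i => Classical.choose (LinearMap.mem_range.1
        (Module.finBasis ℝ (coboundaries d (q + 1)) i).2)))

/-- The Reidemeister torsion `τ(C^*, ω, μ)` (Milnor's ratio of volumes) of a complex
`0 → C^0 → ⋯ → C^n → 0` of finite-dimensional real vector spaces: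
`∏_q ([b^q, h^q, b^{q+1}] / μ_q(h^q)) ^ ((-1)^(q+1))`.
The volume element `ω_q` of `C^q` is the one of the basis `c q`, and `μ q` is the (absolute) volume
function on frames of `H^q`. The value does not depend on the adapted bases; for
`ℤ --m--> ℤ`, tensored with `ℝ`, it is `|m|`. -/
def torsion (n : ℕ) (d : ∀ q, C q →ₗ[ℝ] C (q + 1)) {I : ℕ → Type*} [∀ q, Fintype (I q)]
    (c : ∀ q, Module.Basis (I q) ℝ (C q))
    (μ : ∀ q, (Fin (Module.finrank ℝ (Coh d q)) → Coh d q) → ℝ) : ℝ :=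
  ∏ q ∈ Finset.range (n + 1),
    (relVol (c q) (adaptedBasis d q) / μ q (Module.finBasis ℝ (Coh d q))) ^ ((-1 : ℤ) ^ (q + 1))

end Torsion

/-! ### The universal covering and the local system of a representation -/

section LocalSystem

variable {X : Type*} [TopologicalSpace X] {x₀ : X}

/-- Homotopy classes of paths from the base point `x₀` to `x`: the fibre over `x` of the universal
covering of `X`. -/
abbrev PathClass (x₀ x : X) : Type _ := Path.Homotopic.Quotient x₀ x

/-- The deck transformation action of `π₁(X, x₀)` on the universal covering. In Mathlib the product
`γ * δ` of `π₁` is "first `δ`, then `γ`", so it is precomposition with the inverse loop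
that is a left action. -/
def deck (γ : FundamentalGroup X x₀) {x : X} (p : PathClass x₀ x) : PathClass x₀ x :=
  (FundamentalGroup.toPath γ⁻¹).trans p

variable {R W : Type*} [CommRing R] [AddCommGroup W] [Module R W]

/-- The fibre over `x` of the local system attached to a representation `ρ` of `π₁(X, x₀)` on
`W`: the `π₁`-equivariant functions on the fibre of the universal covering. For
`R = ℝ` it is the fibre `E_x` of the flat bundle `E`. -/
def Fibre (ρ : Representation R (FundamentalGroup X x₀) W) (x : X) :
    Submodule R (PathClass x₀ x → W) where
  carrier := {f | ∀ γ p, f (deck γ p) = ρ γ (f p)}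
  add_mem' hf hg γ p := by simp [hf γ p, hg γ p]
  zero_mem' γ p := by simp
  smul_mem' r f hf γ p := by simp [hf γ p]

theorem trans_assoc' {x y z t : X} (a : Path.Homotopic.Quotient x y)
    (b : Path.Homotopic.Quotient y z) (c : Path.Homotopic.Quotient z t) :
    (a.trans b).trans c = a.trans (b.trans c) :=
  @CategoryTheory.Category.assoc (FundamentalGroupoid X) _ ⟨x⟩ ⟨y⟩ ⟨z⟩ ⟨t⟩ a b c

theorem refl_trans' {x y : X} (a : Path.Homotopic.Quotient x y) :
    (Path.Homotopic.Quotient.refl x).trans a = a :=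
  @CategoryTheory.Category.id_comp (FundamentalGroupoid X) _ ⟨x⟩ ⟨y⟩ a

theorem trans_refl' {x y : X} (a : Path.Homotopic.Quotient x y) :
    a.trans (Path.Homotopic.Quotient.refl y) = a :=
  @CategoryTheory.Category.comp_id (FundamentalGroupoid X) _ ⟨x⟩ ⟨y⟩ a

theorem symm_trans' {x y : X} (a : Path.Homotopic.Quotient x y) :
    a.symm.trans a = Path.Homotopic.Quotient.refl y :=
  @CategoryTheory.Groupoid.inv_comp (FundamentalGroupoid X) _ ⟨x⟩ ⟨y⟩ a

theorem trans_symm' {x y : X} (a : Path.Homotopic.Quotient x y) :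
    a.trans a.symm = Path.Homotopic.Quotient.refl x :=
  @CategoryTheory.Groupoid.comp_inv (FundamentalGroupoid X) _ ⟨x⟩ ⟨y⟩ a

theorem deck_trans (γ : FundamentalGroup X x₀) {x y : X} (p : PathClass x₀ x)
    (c : Path.Homotopic.Quotient x y) : (deck γ p).trans c = deck γ (p.trans c) :=
  trans_assoc' _ _ _

theorem deck_mul (γ δ : FundamentalGroup X x₀) {x : X} (p : PathClass x₀ x) :
    deck (γ * δ) p = deck γ (deck δ p) := by
  unfold deck
  rw [mul_inv_rev]
  exact trans_assoc' _ _ _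

theorem deck_one {x : X} (p : PathClass x₀ x) : deck (1 : FundamentalGroup X x₀) p = p := by
  unfold deck
  rw [inv_one]
  exact refl_trans' p

/-- The deck transformation carrying `p` to `q`. -/
def between {x : X} (p q : PathClass x₀ x) : FundamentalGroup X x₀ :=
  FundamentalGroup.fromPath (p.trans q.symm)

theorem deck_between {x : X} (p q : PathClass x₀ x) : deck (between p q) p = q := by
  unfold deck between
  have : (FundamentalGroup.toPath (FundamentalGroup.fromPath (p.trans q.symm))⁻¹)
      = q.trans p.symm := by
    refine inv_eq_of_mul_eq_one_right (G := FundamentalGroup X x₀)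
      (b := FundamentalGroup.fromPath (q.trans p.symm)) ?_
    change (q.trans p.symm).trans (p.trans q.symm) = Path.Homotopic.Quotient.refl _
    rw [trans_assoc', ← trans_assoc' p.symm, symm_trans', refl_trans', trans_symm']
  rw [this, trans_assoc', symm_trans', trans_refl']

theorem between_deck (γ : FundamentalGroup X x₀) {x : X} (p : PathClass x₀ x) :
    between p (deck γ p) = γ := by
  have h : deck (between p (deck γ p)) p = deck γ p := deck_between _ _
  unfold deck at h
  have h2 := congrArg (fun a => a.trans p.symm) h
  simp only [trans_assoc', trans_symm', trans_refl'] at h2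
  exact inv_injective h2

/-- Evaluation at a point of the universal covering identifies `E_x` with `W`. -/
def Fibre.evalEquiv (ρ : Representation R (FundamentalGroup X x₀) W) {x : X} (p : PathClass x₀ x) :
    Fibre ρ x ≃ₗ[R] W where
  toFun f := f.1 p
  map_add' _ _ := rfl
  map_smul' _ _ := rfl
  invFun w := ⟨fun q => ρ (between p q) w, fun γ q => by
    have : between p (deck γ q) = γ * between p q := by
      conv_lhs => rw [← deck_between p q, ← deck_mul]
      exact between_deck _ _
    change ρ (between p (deck γ q)) w = ρ γ (ρ (between p q) w)
    rw [this, map_mul]; rfl⟩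
  left_inv f := by
    ext q
    have := f.2 (between p q) p
    rw [deck_between] at this
    exact this.symm
  right_inv w := by
    have : between p p = 1 := by
      conv_lhs => rw [← deck_one p]
      rw [deck_one]
      conv_lhs => arg 2; rw [← deck_one p]
      exact between_deck _ _
    change ρ (between p p) w = w
    rw [this, map_one]; rfl

/-- The representation of `π₁` on an invariant lattice. -/
def latticeRep {Γ V : Type*} [Group Γ] [AddCommGroup V] [Module ℝ V] (ρ : Representation ℝ Γ V)
    (M : Submodule ℤ V) (hM : ∀ γ, ∀ m ∈ M, ρ γ m ∈ M) : Representation ℤ Γ M where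
  toFun γ := ((ρ γ).restrictScalars ℤ).restrict (hM γ)
  map_one' := by ext; simp
  map_mul' _ _ := by ext; simp; rfl

end LocalSystem

/-! ### Smooth triangulations -/

section Triangulation

/-- The closed simplex with vertex set `s` in barycentric coordinates. -/
def closedFace {ι : Type*} [Fintype ι] (s : Finset ι) : Set (ι → ℝ) :=
  {x ∈ stdSimplex ℝ ι | ∀ i ∉ s, x i = 0}

theorem convex_closedFace {ι : Type*} [Fintype ι] (s : Finset ι) : Convex ℝ (closedFace s) := by
  intro x hx y hy a b ha hb hab
  refine ⟨convex_stdSimplex ℝ ι hx.1 hy.1 ha hb hab, fun i hi => ?_⟩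
  simp [hx.2 i hi, hy.2 i hi]

theorem single_mem_closedFace {ι : Type*} [Fintype ι] [DecidableEq ι] {s : Finset ι} {a : ι}
    (ha : a ∈ s) : (Pi.single a 1 : ι → ℝ) ∈ closedFace s :=
  ⟨single_mem_stdSimplex ℝ a, fun i hi => Pi.single_eq_of_ne (fun h => hi (by rw [h]; exact ha)) 1⟩

/-- The parameter simplex `Δ^q = {t ∈ ℝ^q : t_k ≥ 0, ∑ t_k ≤ 1}`. -/
def paramSimplex (q : ℕ) : Set (Fin q → ℝ) := {t | (∀ k, 0 ≤ t k) ∧ ∑ k, t k ≤ 1}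

/-- The `q`-simplices of a simplicial complex. -/
abbrev Simplex {ι : Type*} (K : AbstractSimplicialComplex ι) (q : ℕ) : Type _ :=
  {s : Finset ι // s ∈ K.faces ∧ s.card = q + 1}

variable {ι : Type*} [LinearOrder ι]

/-- The vertices `v_0 < ⋯ < v_q` of a `q`-simplex; the simplex is oriented by this ordering. -/
def Simplex.vertex {K : AbstractSimplicialComplex ι} {q : ℕ} (s : Simplex K q) (i : Fin (q + 1)) :
    ι :=
  s.1.orderEmbOfFin s.2.2 i

theorem Simplex.vertex_mem {K : AbstractSimplicialComplex ι} {q : ℕ} (s : Simplex K q)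
    (i : Fin (q + 1)) : s.vertex i ∈ s.1 :=
  Finset.orderEmbOfFin_mem _ _ _

/-- The face `[v_0, …, v̂_i, …, v_{q+1}]` of the simplex `[v_0, …, v_{q+1}]`. -/
def Simplex.face {K : AbstractSimplicialComplex ι} {q : ℕ} (s : Simplex K (q + 1))
    (i : Fin (q + 2)) : Simplex K q :=
  ⟨s.1.erase (s.vertex i), by
    have hc : (s.1.erase (s.vertex i)).card = q + 1 := by
      rw [Finset.card_erase_of_mem (s.vertex_mem i), s.2.2]; rfl
    exact ⟨(K.isRelLowerSet_faces s.2.1).2 (Finset.erase_subset _ _)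
      (Finset.card_pos.1 (by omega)), hc⟩⟩

/-- The affine parametrization of a `q`-simplex by `Δ^q`, in barycentric coordinates:
`t ↦ (1 - ∑ t_k) v_0 + ∑ t_k v_{k+1}`. -/
def Simplex.bary {K : AbstractSimplicialComplex ι} {q : ℕ} (s : Simplex K q) (t : Fin q → ℝ) :
    ι → ℝ :=
  (1 - ∑ k, t k) • Pi.single (s.vertex 0) 1 + ∑ k, t k • Pi.single (s.vertex k.succ) 1

theorem Simplex.bary_mem [Fintype ι] {K : AbstractSimplicialComplex ι} {q : ℕ} (s : Simplex K q)
    {t : Fin q → ℝ} (ht : t ∈ paramSimplex q) : s.bary t ∈ closedFace s.1 := by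
  have hconv := convex_closedFace s.1
  have h := hconv.sum_mem (t := Finset.univ)
    (w := fun k : Fin (q + 1) => (Fin.cons (1 - ∑ k, t k) t : Fin (q + 1) → ℝ) k)
    (z := fun k => Pi.single (s.vertex k) 1)
    (fun k _ => by
      refine Fin.cases ?_ (fun j => ?_) k
      · simpa using ht.2
      · simpa using ht.1 j)
    (by simp [Fin.sum_univ_succ])
    (fun k _ => single_mem_closedFace (s.vertex_mem k))
  simpa [Fin.sum_univ_succ, Simplex.bary] using h

variable [Fintype ι] (n : ℕ) (X : Type*) [TopologicalSpace X]
  [ChartedSpace (EuclideanSpace ℝ (Fin n)) X]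

/-- A smooth triangulation of the `n`-manifold `X`: a finite simplicial complex `K` and a
homeomorphism `|K| → X` (a continuous bijection from a compact space) that restricts to a
smooth immersion on every closed simplex. Only the values of `map` on `|K|` matter. -/
structure SmoothTriangulation (ι : Type*) [LinearOrder ι] [Fintype ι] where
  complex : AbstractSimplicialComplex ι
  map : (ι → ℝ) → X
  continuousOn : ContinuousOn map (⋃ s ∈ complex.faces, closedFace s)
  bijOn : BijOn map (⋃ s ∈ complex.faces, closedFace s) univ
  smooth : ∀ (q : ℕ) (s : Simplex complex q),
    ContMDiffOn 𝓘(ℝ, Fin q → ℝ) (𝓡 n) ∞ (fun t => map (s.bary t)) (paramSimplex q)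
  immersive : ∀ (q : ℕ) (s : Simplex complex q), ∀ t ∈ paramSimplex q, Function.Injective
    (mfderivWithin 𝓘(ℝ, Fin q → ℝ) (𝓡 n) (fun t => map (s.bary t)) (paramSimplex q) t)

variable {n X}

namespace SmoothTriangulation

variable (K : SmoothTriangulation n X ι)

/-- The embedded simplex `Δ^q → X` attached to a `q`-simplex. -/
def param {q : ℕ} (s : Simplex K.complex q) (t : Fin q → ℝ) : X := K.map (s.bary t)

/-- The first vertex of a simplex, as a point of `X`. -/
def vert {q : ℕ} (s : Simplex K.complex q) : X := K.map (Pi.single (s.vertex 0) 1)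

/-- The image in `X` of the straight segment between two points of a closed simplex. -/
def segment {q : ℕ} (s : Simplex K.complex q) {x y : ι → ℝ} (hx : x ∈ closedFace s.1)
    (hy : y ∈ closedFace s.1) : Path (K.map x) (K.map y) where
  toFun r := K.map (AffineMap.lineMap x y (r : ℝ))
  continuous_toFun := by
    refine K.continuousOn.comp_continuous
      (AffineMap.lineMap_continuous.comp continuous_subtype_val) (fun r => ?_)
    refine mem_biUnion s.2.1 ?_
    exact (convex_closedFace s.1).segment_subset hx hy
      (lineMap_mem_segment ℝ x y r.2)
  source' := by simp
  target' := by simp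

/-- The edge of a simplex from its first vertex to the first vertex of its `i`-th face (a constant
path if `i > 0`). -/
def edge {q : ℕ} (s : Simplex K.complex (q + 1)) (i : Fin (q + 2)) :
    Path (K.vert s) (K.vert (s.face i)) :=
  K.segment s (single_mem_closedFace (s.vertex_mem 0))
    (single_mem_closedFace (Finset.mem_of_mem_erase ((s.face i).vertex_mem 0)))

/-- The path in a simplex from its first vertex to the point with parameter `t`. -/
def radial {q : ℕ} (s : Simplex K.complex q) (t : paramSimplex q) :
    Path (K.vert s) (K.param s t) :=
  K.segment s (single_mem_closedFace (s.vertex_mem 0)) (s.bary_mem t.2)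

/-- The Euler characteristic. -/
def eulerChar : ℤ :=
  ∑ q ∈ Finset.range (n + 1), (-1 : ℤ) ^ q * (Nat.card (Simplex K.complex q) : ℤ)

end SmoothTriangulation

end Triangulation

/-! ### Twisted cochains -/

section Cochains

variable {n : ℕ} {X : Type*} [TopologicalSpace X] [ChartedSpace (EuclideanSpace ℝ (Fin n)) X]
  {x₀ : X} {R W : Type*} [CommRing R] [AddCommGroup W] [Module R W]
  {ι : Type*} [LinearOrder ι] [Fintype ι]

/-- The twisted cochains: a `q`-cochain assigns to each `q`-simplex of `K` a flat section of the
local system over that simplex (given by its value at the first vertex). Equivalently: to each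
`q`-simplex of the lifted triangulation of the universal covering (a simplex of `K` and a lift of its
first vertex) an element of `W`, equivariantly under `π₁`. -/
abbrev Cochain (K : SmoothTriangulation n X ι) (ρ : Representation R (FundamentalGroup X x₀) W)
    (q : ℕ) : Type _ :=
  (s : Simplex K.complex q) → Fibre ρ (K.vert s)

/-- The twisted coboundary `(dc)(s) = ∑_i (-1)^i c(∂_i s)`, where the value of `c` on `∂_i s` is
transported along the edge from the first vertex of `s` to that of `∂_i s`. -/
def coboundary (K : SmoothTriangulation n X ι) (ρ : Representation R (FundamentalGroup X x₀) W)
    (q : ℕ) : Cochain K ρ q →ₗ[R] Cochain K ρ (q + 1) where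
  toFun c s := ⟨fun p => ∑ i : Fin (q + 2), (-1 : R) ^ (i : ℕ) •
      (c (s.face i)).1 (p.trans (.mk (K.edge s i))), fun γ p => by
    simp only [deck_trans, (c _).2 γ, map_sum, map_smul]⟩
  map_add' c c' := by
    ext s p
    simp [Finset.sum_add_distrib]
  map_smul' r c := by
    ext s p
    simp [Finset.smul_sum, smul_comm r]

/-- The twisted cohomology of `X`, computed with the triangulation `K`. -/
abbrev TwistedCoh (K : SmoothTriangulation n X ι)
    (ρ : Representation R (FundamentalGroup X x₀) W) (q : ℕ) : Type _ :=
  Coh (coboundary K ρ) q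

instance simplexFintype (K : AbstractSimplicialComplex ι) (q : ℕ) : Fintype (Simplex K q) :=
  Fintype.ofFinite _

variable {V : Type*} [AddCommGroup V] [Module ℝ V]

instance fibreFinite [FiniteDimensional ℝ V] (ρ : Representation ℝ (FundamentalGroup X x₀) V)
    (K : SmoothTriangulation n X ι) {q : ℕ} (s : Simplex K.complex q)
    [PathConnectedSpace X] : FiniteDimensional ℝ (Fibre ρ (K.vert s)) :=
  Module.Finite.equiv
    (Fibre.evalEquiv ρ (.mk (PathConnectedSpace.somePath x₀ (K.vert s)))).symm

/-- The preferred basis `σ_j ⊗ e_k` of the space of `V`-valued `q`-cochains; it depends on a basis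
`θ` of `V` and on a lift `w s` of each simplex `s` to the universal covering. -/
def cochainBasis (K : SmoothTriangulation n X ι)
    (ρ : Representation ℝ (FundamentalGroup X x₀) V) {κ : Type*} (θ : Module.Basis κ ℝ V)
    (w : ∀ (q : ℕ) (s : Simplex K.complex q), PathClass x₀ (K.vert s)) (q : ℕ) :
    Module.Basis (Σ _ : Simplex K.complex q, κ) ℝ (Cochain K ρ q) :=
  (Pi.basis fun _ => θ).map
    (LinearEquiv.piCongrRight fun s => (Fibre.evalEquiv ρ (w q s)).symm)

section Lattice

variable (K : SmoothTriangulation n X ι) (ρ : Representation ℝ (FundamentalGroup X x₀) V)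
  (M : Submodule ℤ V) (hM : ∀ γ, ∀ m ∈ M, ρ γ m ∈ M)

/-- The inclusion of the `M`-valued cochains in the `V`-valued ones. -/
def cochainIncl (q : ℕ) : Cochain K (latticeRep ρ M hM) q →+ Cochain K ρ q where
  toFun c s := ⟨fun p => ((c s).1 p : V), fun γ p =>
    congrArg Subtype.val ((c s).2 γ p)⟩
  map_zero' := rfl
  map_add' _ _ := rfl

theorem cochainIncl_d (q : ℕ) (c : Cochain K (latticeRep ρ M hM) q) :
    cochainIncl K ρ M hM (q + 1) (coboundary K (latticeRep ρ M hM) q c) =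
      coboundary K ρ q (cochainIncl K ρ M hM q c) := by
  ext s p
  simp only [cochainIncl, coboundary, AddMonoidHom.coe_mk, ZeroHom.coe_mk, LinearMap.coe_mk,
    AddHom.coe_mk]
  rw [AddSubmonoidClass.coe_finsetSum]
  refine Finset.sum_congr rfl fun i _ => ?_
  rcases Nat.even_or_odd (i : ℕ) with h | h <;> simp [h.neg_one_pow]

/-- A cocycle with values in `M`, considered as a cohomology class with values in `V`. -/
def cocycleIncl (q : ℕ) : cocycles (coboundary K (latticeRep ρ M hM)) q →ₗ[ℤ] TwistedCoh K ρ q :=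
  AddMonoidHom.toIntLinearMap
    { toFun := fun z => cohClass (coboundary K ρ) q ⟨cochainIncl K ρ M hM q z.1, by
        rw [LinearMap.mem_ker, ← cochainIncl_d, LinearMap.mem_ker.1 z.2, map_zero]⟩
      map_zero' := rfl
      map_add' := fun _ _ => rfl }

/-- The map `H^q(X, M) → H^q(X, V)` induced by `M ⊆ V`. -/
def cohIncl (q : ℕ) : TwistedCoh K (latticeRep ρ M hM) q →ₗ[ℤ] TwistedCoh K ρ q :=
  Submodule.liftQ _ (cocycleIncl K ρ M hM q) (by
    intro z hz
    rw [LinearMap.mem_ker]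
    refine (Submodule.Quotient.mk_eq_zero _).2 ?_
    change (z : Cochain K (latticeRep ρ M hM) q) ∈ coboundaries _ q at hz
    change cochainIncl K ρ M hM q z.1 ∈ coboundaries (coboundary K ρ) q
    cases q with
    | zero =>
      have h0 : (z : Cochain K (latticeRep ρ M hM) 0) = 0 := hz
      change cochainIncl K ρ M hM 0 z.1 = 0
      rw [h0, map_zero]
    | succ q =>
      obtain ⟨c, hc⟩ := hz
      refine ⟨cochainIncl K ρ M hM q c, ?_⟩
      rw [← cochainIncl_d, hc])

/-- The torsion subgroup of `H^q(X, M)`. -/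
abbrev cohTors (q : ℕ) : Submodule ℤ (TwistedCoh K (latticeRep ρ M hM) q) :=
  Submodule.torsion ℤ _

/-- `H^q(X, M)_free = H^q(X, M) / H^q(X, M)_tors`. -/
abbrev CohFree (q : ℕ) : Type _ := TwistedCoh K (latticeRep ρ M hM) q ⧸ cohTors K ρ M hM q

/-- The identification of `H^q(X, M)_free` with a subgroup of `H^q(X, V)`. -/
def cohFreeIncl (q : ℕ) : CohFree K ρ M hM q →ₗ[ℤ] TwistedCoh K ρ q :=
  Submodule.liftQ _ (cohIncl K ρ M hM q) (by
    intro a ha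
    obtain ⟨k, hk⟩ := (Submodule.mem_torsion_iff a).1 ha
    rw [LinearMap.mem_ker]
    have h1 : (k : ℤ) • cohIncl K ρ M hM q a = 0 := by
      rw [← map_smul]
      have : (k : ℤ) • a = 0 := hk
      rw [this, map_zero]
    have h2 : ((k : ℤ) : ℝ) • cohIncl K ρ M hM q a = 0 := by
      rw [Int.cast_smul_eq_zsmul]; exact h1
    have h3 : ((k : ℤ) : ℝ) ≠ 0 := Int.cast_ne_zero.2 (nonZeroDivisors.ne_zero k.2)
    have h4 := congrArg (fun v => ((k : ℤ) : ℝ)⁻¹ • v) h2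
    simpa only [smul_smul, inv_mul_cancel₀ h3, one_smul, smul_zero] using h4)

end Lattice

end Cochains

/-! ### Differential forms with values in the flat bundle -/

section Forms

variable {n : ℕ} {X : Type*} [TopologicalSpace X] [ChartedSpace (EuclideanSpace ℝ (Fin n)) X]
  {x₀ : X} {V : Type*} [NormedAddCommGroup V] [NormedSpace ℝ V]

/-- A function on the universal covering agrees near the point `(x, p)` with the function `α` of the
coordinates in the chart `ψ_i`: for all `y` close to `x` and paths `c` from `x` to `y` that stay close
to `x`, its value at `(y, p · c)` is `α (ψ_i y)`, up to the identification `L y`. -/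
def AgreesNear {A : Type*} {B : X → Type*} (i x : X) (p : PathClass x₀ x)
    (F : ∀ y, PathClass x₀ y → B y) (L : ∀ y, A → B y) (α : EuclideanSpace ℝ (Fin n) → A) : Prop :=
  ∃ U ∈ 𝓝 x, ∀ (y : X) (c : Path x y), range c ⊆ U →
    F y (p.trans (.mk c)) = L y (α (extChartAt (𝓡 n) i y))

/-- A smooth fibre metric on the flat bundle `E` of `ρ`: a smooth family of inner products on `V`,
parametrized by the universal covering and equivariant under `π₁`. -/
structure FibreMetric (n : ℕ) {X : Type*} [TopologicalSpace X]
    [ChartedSpace (EuclideanSpace ℝ (Fin n)) X] {x₀ : X} {V : Type*} [NormedAddCommGroup V]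
    [NormedSpace ℝ V] (ρ : Representation ℝ (FundamentalGroup X x₀) V) where
  inner : ∀ x : X, PathClass x₀ x → (V →L[ℝ] V →L[ℝ] ℝ)
  symm : ∀ x p v w, inner x p v w = inner x p w v
  pos : ∀ x p v, v ≠ 0 → 0 < inner x p v v
  equivariant : ∀ x p γ v w, inner x (deck γ p) (ρ γ v) (ρ γ w) = inner x p v w
  smooth : ∀ (i x : X) (p : PathClass x₀ x), x ∈ (extChartAt (𝓡 n) i).source →
    ∃ β : EuclideanSpace ℝ (Fin n) → (V →L[ℝ] V →L[ℝ] ℝ),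
      ContDiffAt ℝ ∞ β (extChartAt (𝓡 n) i x) ∧ AgreesNear i x p inner (fun _ b => b) β

variable (n x₀ V) in
/-- `V`-valued `q`-forms on the universal covering (no smoothness or equivariance yet); the tangent
space at a point over `x` is identified with `T_x X`. -/
abbrev CoverForm (q : ℕ) : Type _ :=
  ∀ x : X, PathClass x₀ x → (TangentSpace (𝓡 n) x) [⋀^Fin q]→L[ℝ] V

/-- The pull-back to `T_y X` of an alternating form on `ℝ^n` under the differential of the chart
`φ_i`. -/
def chartPull {q : ℕ} (i y : X) (a : (EuclideanSpace ℝ (Fin n)) [⋀^Fin q]→L[ℝ] V) :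
    (TangentSpace (𝓡 n) y) [⋀^Fin q]→L[ℝ] V :=
  ContinuousAlternatingMap.compContinuousLinearMap a
    (mfderiv (𝓡 n) 𝓘(ℝ, EuclideanSpace ℝ (Fin n)) (extChartAt (𝓡 n) i) y)

/-- `α` is the expression of `φ` in the chart `ψ_i`, near the point `(x, p)` of the universal
covering. -/
def IsLocalExpr {q : ℕ} (i x : X) (p : PathClass x₀ x) (φ : CoverForm n x₀ V q)
    (α : EuclideanSpace ℝ (Fin n) → (EuclideanSpace ℝ (Fin n)) [⋀^Fin q]→L[ℝ] V) : Prop :=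
  AgreesNear i x p φ (fun y => chartPull i y) α

/-- Smooth `E`-valued `q`-forms on `X`: smooth `π₁`-equivariant `V`-valued `q`-forms on the universal
covering. -/
def IsForm {q : ℕ} (ρ : Representation ℝ (FundamentalGroup X x₀) V) (φ : CoverForm n x₀ V q) :
    Prop :=
  (∀ x p γ v, φ x (deck γ p) v = ρ γ (φ x p v)) ∧
  ∀ (i x : X) (p : PathClass x₀ x), x ∈ (extChartAt (𝓡 n) i).source →
    ∃ α, ContDiffAt ℝ ∞ α (extChartAt (𝓡 n) i x) ∧ IsLocalExpr i x p φ α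

/-- `η = dφ`, the (flat) exterior derivative, computed in charts. -/
def IsExtDeriv {q : ℕ} (φ : CoverForm n x₀ V q) (η : CoverForm n x₀ V (q + 1)) : Prop :=
  ∀ (i x : X) (p : PathClass x₀ x), x ∈ (extChartAt (𝓡 n) i).source →
    ∃ α, ContDiffAt ℝ ∞ α (extChartAt (𝓡 n) i x) ∧ IsLocalExpr i x p φ α ∧
      η x p = chartPull i x (extDeriv α (extChartAt (𝓡 n) i x))

/-- The coordinate vector field `∂_k` of the chart `ψ_i`, at the point with coordinates `y`. -/
def coordVec (i : X) (y : EuclideanSpace ℝ (Fin n)) (k : Fin n) :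
    TangentSpace (𝓡 n) ((extChartAt (𝓡 n) i).symm y) :=
  mfderiv 𝓘(ℝ, EuclideanSpace ℝ (Fin n)) (𝓡 n) (extChartAt (𝓡 n) i).symm y
    (EuclideanSpace.single k (1 : ℝ))

variable {ι : Type*} [LinearOrder ι] [Fintype ι]

/-- The integral of `φ` over the lift of the simplex `s` whose first vertex is the point `p` of the
universal covering. -/
def integral (K : SmoothTriangulation n X ι) {q : ℕ} (φ : CoverForm n x₀ V q)
    (s : Simplex K.complex q) (p : PathClass x₀ (K.vert s)) : V :=
  ∫ t : paramSimplex q, φ (K.param s t) (p.trans (.mk (K.radial s t))) fun k =>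
    mfderivWithin 𝓘(ℝ, Fin q → ℝ) (𝓡 n) (K.param s) (paramSimplex q) t (Pi.single k (1 : ℝ))
    ∂(Measure.comap Subtype.val volume)

variable [IsManifold (𝓡 n) ∞ X]

variable (n X) in
/-- A smooth Riemannian metric on `X`. -/
abbrev Metric : Type _ :=
  Bundle.ContMDiffRiemannianMetric (𝓡 n) ∞ (EuclideanSpace ℝ (Fin n))
    (fun x : X => TangentSpace (𝓡 n) x)

/-- The matrix `g_{kl}` of the metric in the chart `ψ_i`, at the point with coordinates `y`. -/
def metricMatrix (g : Metric n X) (i : X) (y : EuclideanSpace ℝ (Fin n)) :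
    Matrix (Fin n) (Fin n) ℝ :=
  Matrix.of fun k l => g.inner ((extChartAt (𝓡 n) i).symm y) (coordVec i y k) (coordVec i y l)

variable [PathConnectedSpace X]

/-- The pointwise inner product of two `E`-valued `q`-forms at the point with coordinates `y` in the
chart `ψ_i`:
`(1/q!) ∑_{I,J} g^{I_1 J_1} ⋯ g^{I_q J_q} h(φ(∂_{I_1}, …, ∂_{I_q}), η(∂_{J_1}, …, ∂_{J_q}))`.
It does not depend on the lift of that point to the universal covering. -/
def formInner (g : Metric n X) {ρ : Representation ℝ (FundamentalGroup X x₀) V}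
    (h : FibreMetric n ρ) {q : ℕ} (φ η : CoverForm n x₀ V q) (i : X)
    (y : EuclideanSpace ℝ (Fin n)) : ℝ :=
  let x := (extChartAt (𝓡 n) i).symm y
  let p : PathClass x₀ x := .mk (PathConnectedSpace.somePath x₀ x)
  (Nat.factorial q : ℝ)⁻¹ * ∑ I : Fin q → Fin n, ∑ J : Fin q → Fin n,
    (∏ k, (metricMatrix g i y)⁻¹ (I k) (J k)) *
      h.inner x p (φ x p fun k => coordVec i y (I k)) (η x p fun k => coordVec i y (J k))

variable [T2Space X] [CompactSpace X]

variable (n X) in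
/-- A smooth partition of unity on `X` subordinate to the charts. -/
def chartPartition : SmoothPartitionOfUnity X (𝓡 n) X univ :=
  Classical.choose (SmoothPartitionOfUnity.exists_isSubordinate_chartAt_source (𝓡 n) X)

/-- The `L²` inner product of `E`-valued forms: the integral over `X` of the pointwise inner product
with respect to the Riemannian density, computed in charts with a partition of unity. -/
def L2Inner (g : Metric n X) {ρ : Representation ℝ (FundamentalGroup X x₀) V}
    (h : FibreMetric n ρ) {q : ℕ} (φ η : CoverForm n x₀ V q) : ℝ :=
  ∑ᶠ i : X, ∫ y in (extChartAt (𝓡 n) i).target,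
    chartPartition n X i ((extChartAt (𝓡 n) i).symm y) * formInner g h φ η i y *
      √ (metricMatrix g i y).det

/-- `ξ = d^* φ`, where `d^*` is the formal adjoint of `d` with respect to the `L²` inner products. -/
def IsCodiff (g : Metric n X) {ρ : Representation ℝ (FundamentalGroup X x₀) V}
    (h : FibreMetric n ρ) {q : ℕ} (φ : CoverForm n x₀ V (q + 1)) (ξ : CoverForm n x₀ V q) : Prop :=
  IsForm ρ ξ ∧ ∀ (η : CoverForm n x₀ V q) (θ : CoverForm n x₀ V (q + 1)),
    IsForm ρ η → IsForm ρ θ → IsExtDeriv η θ → L2Inner g h ξ η = L2Inner g h φ θ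

/-- Harmonic `E`-valued forms: smooth forms `φ` with `Δφ = d d^* φ + d^* d φ = 0`. -/
def IsHarmonic (g : Metric n X) {ρ : Representation ℝ (FundamentalGroup X x₀) V}
    (h : FibreMetric n ρ) : ∀ {q : ℕ}, CoverForm n x₀ V q → Prop
  | 0, φ => IsForm ρ φ ∧ ∃ dφ : CoverForm n x₀ V 1,
      IsForm ρ dφ ∧ IsExtDeriv φ dφ ∧ IsCodiff g h dφ 0
  | q + 1, φ => IsForm ρ φ ∧
      ∃ (dφ : CoverForm n x₀ V (q + 2)) (δφ : CoverForm n x₀ V q) (dδφ : CoverForm n x₀ V (q + 1)),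
        IsForm ρ dφ ∧ IsExtDeriv φ dφ ∧ IsCodiff g h φ δφ ∧
        IsForm ρ dδφ ∧ IsExtDeriv δφ dδφ ∧ IsCodiff g h dφ (-dδφ)

/-- `rep` is the inverse of the Hodge-de Rham isomorphism: `rep a` is the one and only harmonic form
whose integrals over the simplices form a cocycle with class `a`. -/
def IsHarmonicRep (g : Metric n X) {ρ : Representation ℝ (FundamentalGroup X x₀) V}
    (h : FibreMetric n ρ) (K : SmoothTriangulation n X ι) (q : ℕ)
    (rep : TwistedCoh K ρ q →ₗ[ℝ] CoverForm n x₀ V q) : Prop :=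
  ∀ a φ, φ = rep a ↔ IsHarmonic g h φ ∧ ∃ z : cocycles (coboundary K ρ) q,
    (∀ s p, (z.1 s).1 p = integral K φ s p) ∧ cohClass (coboundary K ρ) q z = a

open Classical in
/-- The inverse of the Hodge-de Rham isomorphism `ℋ^q(X; E) ≅ H^q(X; V)` (the Hodge-de Rham theorem
states that it exists, and then it is unique). -/
def harmonicRep (g : Metric n X) {ρ : Representation ℝ (FundamentalGroup X x₀) V}
    (h : FibreMetric n ρ) (K : SmoothTriangulation n X ι) (q : ℕ) :
    TwistedCoh K ρ q →ₗ[ℝ] CoverForm n x₀ V q :=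
  if H : ∃ rep, IsHarmonicRep g h K q rep then H.choose else 0

/-- The inner product in `H^q(X; V)` induced by the `L²` inner product of harmonic forms. -/
def cohInner (g : Metric n X) {ρ : Representation ℝ (FundamentalGroup X x₀) V}
    (h : FibreMetric n ρ) (K : SmoothTriangulation n X ι) (q : ℕ) (a b : TwistedCoh K ρ q) : ℝ :=
  L2Inner g h (harmonicRep g h K q a) (harmonicRep g h K q b)

/-- The Reidemeister torsion `τ_X(ρ, h)`, computed with the triangulation `K`, the lifts `w` of its
simplices and the volume element of `V` given by the basis `θ`. The volume of a frame of `H^q(X; V)`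
is taken with respect to the inner product `cohInner`. -/
def reidemeisterTorsion [FiniteDimensional ℝ V] (g : Metric n X)
    {ρ : Representation ℝ (FundamentalGroup X x₀) V}
    (h : FibreMetric n ρ) (K : SmoothTriangulation n X ι) {κ : Type*} [Fintype κ]
    (θ : Module.Basis κ ℝ V)
    (w : ∀ (q : ℕ) (s : Simplex K.complex q), PathClass x₀ (K.vert s)) : ℝ :=
  torsion n (coboundary K ρ) (cochainBasis K ρ θ w) (fun q => gramVol (cohInner g h K q))

/-- The regulator `R(ρ, h) = ∏_q R_q ^ ((-1)^q)`, where `R_q = √|det G_q|` and `G_q` is the Gram matrix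
of the basis `e q` of `H^q(X, M)_free`. -/
def regulator (g : Metric n X) {ρ : Representation ℝ (FundamentalGroup X x₀) V}
    (h : FibreMetric n ρ) (K : SmoothTriangulation n X ι) (M : Submodule ℤ V)
    (hM : ∀ γ, ∀ m ∈ M, ρ γ m ∈ M) {r : ℕ → ℕ}
    (e : ∀ q, Module.Basis (Fin (r q)) ℤ (CohFree K ρ M hM q)) : ℝ :=
  ∏ q ∈ Finset.range (n + 1),
    gramVol (cohInner g h K q) (fun k => cohFreeIncl K ρ M hM q (e q k)) ^ ((-1 : ℤ) ^ q)

end Forms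

end

end Reidemeister

open Reidemeister

/-!
The real cochain complex `C^*(K; V)` contains the lattice complex `C^*(K; M)`: lifts of the simplices
and a `ℤ`-basis of `M` give a `ℤ`-basis of the latter which is an `ℝ`-basis of the former. The theorem
is a statement about such a pair of complexes (`torsion_eq_of_lattice`), applied to any bilinear forms
on the real cohomology.

In one degree, choose a `ℤ`-basis of the cochains consisting of a basis of the saturation of the
coboundaries (the cocycles with torsion class), of lifts of the given basis of `H^q(X, M)_free`, and
of lifts of a basis of the integral coboundaries of degree `q + 1`. Its volume is one. Replacing its
first part by a basis of the integral coboundaries multiplies the volume by the index of the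
coboundaries in their saturation, which is the order of the torsion of `H^q(X, M)`
(`relVol_eq_card_quotient`, `card_torsionCocycles_quotient`). Comparing with an arbitrary adapted
basis (`relVol_adaptedBasis`) costs three more determinants, because the change of basis is block
triangular (`relVol_of_exact`). The determinant on `H^q` turns the volume of the frame `h^q` into
the volume of the basis of `H^q(X, M)_free` (`gramVol_eq_relVol_mul`); those on the coboundaries of
degrees `q` and `q + 1` cancel in the alternating product (`prod_mul_succ_zpow`). A general volume
element `θ` of `V` changes the product by `|θ / M|` to the power of the Euler characteristic, up to
sign of the exponent (`relVol_cochainBasis`, `prod_pow_zpow_eq`).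

Two facts about the geometric objects are needed. The twisted coboundary squares to zero, because two
consecutive edges of a simplex are homotopic to the third one (`coboundary_coboundary`), and there
are no cochains above the dimension of `X` (`SmoothTriangulation.le_of_simplex`). And the inner
product on cohomology is bilinear (`cohBilinForm`), which amounts to the integrability of the
pointwise inner products of smooth forms in charts (`integrableOn_formInner`). Bilinearity is all
that is used of it: if its Gram determinants vanish, both sides of the formula vanish as well.
-/

namespace Reidemeister

/-! ### Volumes and changes of basis -/

section Volumes

/-- Reindexing the family does not change its volume. -/
theorem relVol_comp_equiv {W I J J' : Type*} [AddCommGroup W] [Module ℝ W] [Fintype I]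
    [Fintype J] [DecidableEq J] [Fintype J'] [DecidableEq J'] (c : Module.Basis I ℝ W)
    (v : J → W) (τ : J' ≃ J) : relVol c (v ∘ τ) = relVol c v := by
  unfold relVol
  simp only
  rw [← Matrix.det_submatrix_equiv_self τ]
  rfl

variable {W I J : Type*} [AddCommGroup W] [Module ℝ W] [Fintype I] [Fintype J] [DecidableEq I]
  [DecidableEq J]

/-- For as many vectors as the dimension, the volume is the absolute value of a determinant. -/
theorem relVol_eq_abs_det (c : Module.Basis I ℝ W) (v : J → W) (σ : I ≃ J) :
    relVol c v = |c.det (v ∘ σ)| := by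
  set B : Matrix I I ℝ := Matrix.of fun j i => c.repr (v (σ j)) i with hB
  have h1 : (Matrix.of fun j i => c.repr (v j) i : Matrix J I ℝ) = B.submatrix σ.symm id := by
    ext j i; simp [hB]
  have h2 : c.det (v ∘ σ) = B.det := by
    rw [Module.Basis.det_apply, ← Matrix.det_transpose]
    rfl
  have h3 : B.submatrix σ.symm id * (B.submatrix σ.symm id).transpose
      = (B * B.transpose).submatrix σ.symm σ.symm := by
    rw [Matrix.transpose_submatrix]
    exact (Matrix.submatrix_mul B B.transpose σ.symm id σ.symm Function.bijective_id).symm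
  unfold relVol
  simp only
  rw [h1, h3, Matrix.det_submatrix_equiv_self, Matrix.det_mul, Matrix.det_transpose,
    Real.sqrt_mul_self_eq_abs, h2]

theorem relVol_ne_zero (c : Module.Basis I ℝ W) (v : Module.Basis J ℝ W) : relVol c v ≠ 0 := by
  have h := (c.isUnit_det (v.reindex (c.indexEquiv v).symm)).ne_zero
  rw [relVol_eq_abs_det c v (c.indexEquiv v)]
  have h' : (v ∘ (c.indexEquiv v)) = v.reindex (c.indexEquiv v).symm := by ext; simp
  rw [h']
  exact abs_ne_zero.2 h

/-- The volume of a family is multiplicative in a change of the reference basis. -/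
theorem relVol_mul {I' : Type*} [Fintype I'] [DecidableEq I'] (c : Module.Basis I ℝ W)
    (c' : Module.Basis I' ℝ W) (v : J → W) (hc : Fintype.card J = Fintype.card I) :
    relVol c v = relVol c c' * relVol c' v := by
  let σ : I ≃ I' := c.indexEquiv c'
  let τ : I ≃ J := (Fintype.equivOfCardEq hc).symm
  have h' : (c' ∘ σ) = c'.reindex σ.symm := by ext; simp
  rw [relVol_eq_abs_det c v τ, relVol_eq_abs_det c c' σ, relVol_eq_abs_det c' v (σ.symm.trans τ),
    ← abs_mul, h']
  congr 1
  have h2 : c'.det (v ∘ (σ.symm.trans τ)) = (c'.reindex σ.symm).det (v ∘ τ) := by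
    rw [Module.Basis.det_reindex]
    rfl
  rw [h2, Module.Basis.det_apply, Module.Basis.det_apply, Module.Basis.det_apply,
    ← Matrix.det_mul, Module.Basis.toMatrix_mul_toMatrix]

/-- The volume of a family for a bilinear form is multiplied by the volume of a change of basis. -/
theorem gramVol_eq_relVol_mul (B : LinearMap.BilinForm ℝ W) (c : Module.Basis I ℝ W)
    (v : J → W) (hc : Fintype.card J = Fintype.card I) :
    gramVol (fun x y => B x y) v = relVol c v * gramVol (fun x y => B x y) c := by
  let τ : I ≃ J := (Fintype.equivOfCardEq hc).symm
  have key : (Matrix.of fun k l => B (v (τ k)) (v (τ l)))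
      = (c.toMatrix (v ∘ τ)).transpose * (Matrix.of fun k l => B (c k) (c l))
          * c.toMatrix (v ∘ τ) := by
    ext k l
    have h1 : v (τ k) = ∑ i, c.repr (v (τ k)) i • c i := (c.sum_repr _).symm
    have h2 : v (τ l) = ∑ i, c.repr (v (τ l)) i • c i := (c.sum_repr _).symm
    conv_lhs => rw [Matrix.of_apply, h1, h2]
    simp only [map_sum, map_smul, LinearMap.sum_apply, LinearMap.smul_apply, Matrix.mul_apply,
      Matrix.transpose_apply, Matrix.of_apply, Module.Basis.toMatrix_apply, Function.comp_apply,
      smul_eq_mul, Finset.sum_mul, Finset.mul_sum]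
    refine Finset.sum_congr rfl fun i _ => Finset.sum_congr rfl fun j _ => ?_
    ring
  have h0 : (Matrix.of fun k l => B (v k) (v l)).det
      = (Matrix.of fun k l => B (v (τ k)) (v (τ l))).det := by
    rw [← Matrix.det_submatrix_equiv_self τ]
    rfl
  rw [relVol_eq_abs_det c v τ, Module.Basis.det_apply]
  unfold gramVol
  rw [h0, key, Matrix.det_mul, Matrix.det_mul, Matrix.det_transpose]
  rw [show ∀ a b : ℝ, a * b * a = (a * a) * b from fun a b => by ring, abs_mul, Real.sqrt_mul
    (abs_nonneg _), abs_mul, Real.sqrt_mul_self (abs_nonneg _)]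

end Volumes

/-! ### Exact sequences -/

section Extension

variable {R : Type*} [CommRing R] {U W Q I J : Type*} [AddCommGroup U] [Module R U]
  [AddCommGroup W] [Module R W] [AddCommGroup Q] [Module R Q]

/-- In an exact sequence `0 → U → W → Q → 0`, a basis of `U` and lifts of a basis of `Q` form a
basis of `W`. -/
theorem exists_basis_of_exact (i : U →ₗ[R] W) (p : W →ₗ[R] Q) (hi : Function.Injective i)
    (hp : LinearMap.ker p ≤ LinearMap.range i) (hpi : ∀ u, p (i u) = 0)
    (bU : Module.Basis I R U) (bQ : Module.Basis J R Q) (s : J → W) (hs : ∀ j, p (s j) = bQ j) :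
    ∃ b : Module.Basis (I ⊕ J) R W, (b : I ⊕ J → W) = Sum.elim (fun k => i (bU k)) s := by
  have hps : p ∘ s = bQ := funext hs
  have hli : LinearIndependent R (Sum.elim (fun k => i (bU k)) s) := by
    have h1 : LinearIndependent R (fun k => i (bU k)) :=
      bU.linearIndependent.map' i (LinearMap.ker_eq_bot.2 hi)
    refine LinearIndependent.sum_type h1 ?_ ?_
    · exact LinearIndependent.of_comp p (by rw [hps]; exact bQ.linearIndependent)
    · rw [Submodule.disjoint_def]
      intro x hx1 hx2
      have hpx : p x = 0 := by
        have : Submodule.span R (range fun k => i (bU k)) ≤ LinearMap.ker p := by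
          rw [Submodule.span_le]
          rintro _ ⟨k, rfl⟩
          exact hpi _
        exact this hx1
      obtain ⟨l, rfl⟩ := (Finsupp.mem_span_range_iff_exists_finsupp).1 hx2
      rw [map_finsuppSum] at hpx
      simp only [map_smul, hs] at hpx
      have hl : l = 0 := by
        have := linearIndependent_iff.1 bQ.linearIndependent l
        exact this hpx
      simp [hl]
  refine ⟨Module.Basis.mk hli ?_, Module.Basis.coe_mk _ _⟩
  intro x _
  have hx : p x ∈ Submodule.span R (range bQ) := by rw [bQ.span_eq]; trivial
  obtain ⟨l, hl⟩ := (Finsupp.mem_span_range_iff_exists_finsupp).1 hx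
  have hk : x - (l.sum fun j a => a • s j) ∈ LinearMap.ker p := by
    rw [LinearMap.mem_ker, map_sub, map_finsuppSum]
    simp only [map_smul, hs]
    rw [hl, sub_self]
  obtain ⟨u, hu⟩ := hp hk
  have hu2 : i u ∈ Submodule.span R (range (Sum.elim (fun k => i (bU k)) s)) := by
    have : u ∈ Submodule.span R (range bU) := by rw [bU.span_eq]; trivial
    have := Submodule.mem_map_of_mem (f := i) this
    rw [Submodule.map_span] at this
    refine Submodule.span_mono ?_ this
    rintro _ ⟨_, ⟨k, rfl⟩, rfl⟩
    exact ⟨Sum.inl k, rfl⟩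
  have hs2 : (l.sum fun j a => a • s j)
      ∈ Submodule.span R (range (Sum.elim (fun k => i (bU k)) s)) := by
    refine Submodule.sum_mem _ fun j _ => Submodule.smul_mem _ _ (Submodule.subset_span ?_)
    exact ⟨Sum.inr j, rfl⟩
  have : x = i u + (l.sum fun j a => a • s j) := by rw [hu]; abel
  rw [this]
  exact add_mem hu2 hs2

end Extension

section ExtensionReal

variable {U W Q I J I' J' : Type*} [AddCommGroup U] [Module ℝ U]
  [AddCommGroup W] [Module ℝ W] [AddCommGroup Q] [Module ℝ Q] [Fintype I] [Fintype J]
  [DecidableEq I] [DecidableEq J] [Fintype I'] [Fintype J'] [DecidableEq I'] [DecidableEq J']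

/-- Volumes are multiplicative in an exact sequence `0 → U → W → Q → 0`: the matrix of the change
of basis is block triangular. -/
theorem relVol_of_exact (i : U →ₗ[ℝ] W) (p : W →ₗ[ℝ] Q) (hpi : ∀ u, p (i u) = 0)
    (bU : Module.Basis I ℝ U) (bQ : Module.Basis J ℝ Q) (bW : Module.Basis (I ⊕ J) ℝ W)
    (h₁ : ∀ k, bW (Sum.inl k) = i (bU k)) (h₂ : ∀ j, p (bW (Sum.inr j)) = bQ j)
    (vU : I' → U) (vQ : J' → Q) (v : I' ⊕ J' → W)
    (hv₁ : ∀ k, v (Sum.inl k) = i (vU k)) (hv₂ : ∀ j, p (v (Sum.inr j)) = vQ j)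
    (hI : Fintype.card I' = Fintype.card I) (hJ : Fintype.card J' = Fintype.card J) :
    relVol bW v = relVol bU vU * relVol bQ vQ := by
  let σ : I ≃ I' := (Fintype.equivOfCardEq hI).symm
  let τ : J ≃ J' := (Fintype.equivOfCardEq hJ).symm
  rw [relVol_eq_abs_det bW v (Equiv.sumCongr σ τ), relVol_eq_abs_det bU vU σ,
    relVol_eq_abs_det bQ vQ τ, ← abs_mul]
  congr 1
  have hiu : ∀ u, bW.repr (i u) = Finsupp.mapDomain Sum.inl (bU.repr u) := by
    intro u
    apply bW.repr.symm.injective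
    rw [LinearEquiv.symm_apply_apply, Module.Basis.repr_symm_apply,
      Finsupp.linearCombination_mapDomain]
    conv_lhs => rw [← bU.linearCombination_repr u, Finsupp.apply_linearCombination]
    congr 2
    ext k
    simp [h₁]
  have hpw : ∀ w j, bQ.repr (p w) j = bW.repr w (Sum.inr j) := by
    intro w j
    have hw := bW.sum_repr w
    rw [Fintype.sum_sum_type] at hw
    have : p w = ∑ j, bW.repr w (Sum.inr j) • bQ j := by
      conv_lhs => rw [← hw]
      simp [h₁, h₂, hpi]
    rw [this, bQ.repr_sum_self]
  have key : bW.toMatrix (v ∘ Equiv.sumCongr σ τ) =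
      Matrix.fromBlocks (bU.toMatrix (vU ∘ σ))
        (Matrix.of fun k j => bW.repr (v (Sum.inr (τ j))) (Sum.inl k)) 0
        (bQ.toMatrix (vQ ∘ τ)) := by
    ext a b
    rcases a with a | a <;> rcases b with b | b
    · simp [Module.Basis.toMatrix_apply, hv₁, hiu, Finsupp.mapDomain_apply Sum.inl_injective]
    · simp [Module.Basis.toMatrix_apply]
    · simp [Module.Basis.toMatrix_apply, hv₁, hiu, Finsupp.mapDomain_of_notMem_range]
    · simp [Module.Basis.toMatrix_apply, ← hv₂, hpw]
  rw [Module.Basis.det_apply, key, Matrix.det_fromBlocks_zero₂₁]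
  rfl

end ExtensionReal

/-! ### Lattices in real vector spaces -/

section IntegralStructure

variable {L C I J A : Type*} [AddCommGroup L] [AddCommGroup C] [Module ℝ C]
  [AddCommGroup A]

/-- Real coordinates of a lattice vector are its integral coordinates. -/
theorem repr_apply_eq_intCast (b : Module.Basis I ℤ L) (c : Module.Basis I ℝ C) (f : L →+ C)
    (hf : ∀ i, f (b i) = c i) (x : L) (i : I) : c.repr (f x) i = (b.repr x i : ℝ) := by
  have hx : f x = (b.repr x).sum fun i k => (k : ℝ) • c i := by
    conv_lhs => rw [← b.linearCombination_repr x, Finsupp.linearCombination_apply, map_finsuppSum]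
    refine Finsupp.sum_congr fun i _ => ?_
    have := map_intCast_smul f ℤ ℝ (b.repr x i) (b i)
    rw [hf] at this
    simpa using this
  have h2 : f x = Finsupp.linearCombination ℝ c
      ((b.repr x).mapRange (Int.cast : ℤ → ℝ) Int.cast_zero) := by
    rw [hx, Finsupp.linearCombination_apply, Finsupp.sum_mapRange_index]
    simp
  rw [h2, c.repr_linearCombination, Finsupp.mapRange_apply]

/-- A `ℤ`-linearly independent family of a lattice is `ℝ`-linearly independent. -/
theorem linearIndependent_of_lattice [Finite I] (b : Module.Basis I ℤ L) (c : Module.Basis I ℝ C)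
    (f : L →+ C) (hf : ∀ i, f (b i) = c i) {v : J → L} (hv : LinearIndependent ℤ v) :
    LinearIndependent ℝ (fun j => f (v j)) := by
  have h1 : LinearIndependent ℤ (fun j => (b.equivFun (v j) : I → ℤ)) :=
    hv.map' b.equivFun.toLinearMap b.equivFun.ker
  have h2 := (linearIndependent_algebraMap_comp_iff (R := ℤ) (S := ℝ)).2 h1
  refine LinearIndependent.of_comp c.equivFun.toLinearMap ?_
  have h3 : (c.equivFun.toLinearMap ∘ fun j => f (v j))
      = fun j => algebraMap ℤ ℝ ∘ (b.equivFun (v j) : I → ℤ) := by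
    funext j i
    simpa using repr_apply_eq_intCast b c f hf (v j) i
  rw [h3]
  exact h2

/-- A `ℤ`-basis of a subgroup of a lattice is an `ℝ`-basis of the subspace spanned by it. -/
theorem exists_basis_of_span [Finite I] (b : Module.Basis I ℤ L) (c : Module.Basis I ℝ C)
    (f : L →+ C) (hf : ∀ i, f (b i) = c i) (bA : Module.Basis J ℤ A) (g : A →ₗ[ℤ] L)
    (hg : Function.Injective g) (T : Submodule ℝ C)
    (hT : T = Submodule.span ℝ (range fun a => f (g a))) :
    ∃ B : Module.Basis J ℝ T, ∀ j, (B j : C) = f (g (bA j)) := by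
  have hli := linearIndependent_of_lattice b c f hf
    (bA.linearIndependent.map' g (LinearMap.ker_eq_bot.2 hg))
  have hspan : Submodule.span ℝ (range fun j => f (g (bA j))) = T := by
    rw [hT]
    refine le_antisymm (Submodule.span_mono ?_) (Submodule.span_le.2 ?_)
    · rintro _ ⟨j, rfl⟩
      exact ⟨bA j, rfl⟩
    · rintro _ ⟨a, rfl⟩
      simp only [SetLike.mem_coe]
      rw [← bA.linearCombination_repr a, Finsupp.linearCombination_apply, map_finsuppSum,
        map_finsuppSum]
      refine Submodule.sum_mem _ fun j _ => ?_
      simp only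
      rw [g.map_smul]
      have := map_intCast_smul f ℤ ℝ (bA.repr a j) (g (bA j))
      simp only [Int.cast_id] at this
      rw [this]
      exact Submodule.smul_mem _ _ (Submodule.subset_span ⟨j, rfl⟩)
  refine ⟨(Module.Basis.span hli).map (LinearEquiv.ofEq _ _ hspan), fun j => ?_⟩
  rw [Module.Basis.map_apply, LinearEquiv.coe_ofEq_apply]
  exact congrArg Subtype.val (Module.Basis.span_apply hli j)

/-- The covolume of a subgroup of full rank is its index. -/
theorem relVol_eq_card_quotient [Fintype I] [DecidableEq I] [Fintype J] [DecidableEq J]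
    (b : Module.Basis I ℤ L) (c : Module.Basis I ℝ C) (f : L →+ C) (hf : ∀ i, f (b i) = c i)
    (N : Submodule ℤ L) (bN : Module.Basis J ℤ N) (hc : Fintype.card J = Fintype.card I) :
    relVol c (fun j => f (bN j)) = Nat.card (L ⧸ N) := by
  let σ : I ≃ J := (Fintype.equivOfCardEq hc).symm
  have : Module.Free ℤ L := Module.Free.of_basis b
  have : Module.Finite ℤ L := Module.Finite.of_basis b
  rw [relVol_eq_abs_det c _ σ, ← Submodule.natAbs_det_basis_change b N (bN.reindex σ.symm),
    Nat.cast_natAbs, Int.cast_abs, Module.Basis.det_apply, Module.Basis.det_apply, Int.cast_det]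
  congr 2
  ext i j
  simp [Module.Basis.toMatrix_apply, repr_apply_eq_intCast b c f hf]

end IntegralStructure

/-! ### Integral and real cocycles and coboundaries -/

section Complexes

/-- Coboundaries are cocycles. -/
theorem coboundaries_le_cocycles {R : Type*} [CommRing R] {C : ℕ → Type*}
    [∀ q, AddCommGroup (C q)] [∀ q, Module R (C q)] (d : ∀ q, C q →ₗ[R] C (q + 1))
    (hd : ∀ q x, d (q + 1) (d q x) = 0) (q : ℕ) : coboundaries d q ≤ cocycles d q := by
  cases q with
  | zero => exact bot_le
  | succ q =>
    rintro _ ⟨x, rfl⟩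
    exact hd q x

variable {L C : ℕ → Type*} [∀ q, AddCommGroup (L q)]
  [∀ q, AddCommGroup (C q)] [∀ q, Module ℝ (C q)]
  {dL : ∀ q, L q →ₗ[ℤ] L (q + 1)} {dC : ∀ q, C q →ₗ[ℝ] C (q + 1)} {f : ∀ q, L q →+ C q}
  {I : ℕ → Type*}

/-- The real coboundaries are spanned by the integral ones. -/
theorem coboundaries_eq_span (hdf : ∀ q x, f (q + 1) (dL q x) = dC q (f q x))
    (b : ∀ q, Module.Basis (I q) ℤ (L q)) (c : ∀ q, Module.Basis (I q) ℝ (C q))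
    (hf : ∀ q i, f q (b q i) = c q i) (q : ℕ) :
    coboundaries dC q = Submodule.span ℝ (range fun x : coboundaries dL q => f q x) := by
  cases q with
  | zero =>
    symm
    refine Submodule.span_eq_bot.2 ?_
    rintro _ ⟨x, rfl⟩
    have : (x : L 0) = 0 := x.2
    simp [this]
  | succ q =>
    refine le_antisymm ?_ (Submodule.span_le.2 ?_)
    · change LinearMap.range (dC q) ≤ _
      rw [LinearMap.range_eq_map, ← (c q).span_eq, Submodule.map_span_le]
      rintro _ ⟨i, rfl⟩
      rw [← hf, ← hdf]
      exact Submodule.subset_span ⟨⟨dL q (b q i), ⟨_, rfl⟩⟩, rfl⟩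
    · rintro _ ⟨⟨_, x, rfl⟩, rfl⟩
      exact ⟨f q x, (hdf q x).symm⟩

/-- The real cocycles are spanned by the integral ones, by a count of dimensions. -/
theorem cocycles_eq_span [∀ q, Fintype (I q)]
    (hdf : ∀ q x, f (q + 1) (dL q x) = dC q (f q x))
    (b : ∀ q, Module.Basis (I q) ℤ (L q)) (c : ∀ q, Module.Basis (I q) ℝ (C q))
    (hf : ∀ q i, f q (b q i) = c q i) (q : ℕ) :
    cocycles dC q = Submodule.span ℝ (range fun x : cocycles dL q => f q x) := by
  have hfree : ∀ q, Module.Free ℤ (L q) := fun q => Module.Free.of_basis (b q)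
  have hfin : ∀ q, Module.Finite ℤ (L q) := fun q => Module.Finite.of_basis (b q)
  have hfinC : ∀ q, Module.Finite ℝ (C q) := fun q => Module.Finite.of_basis (c q)
  obtain ⟨B, -⟩ := exists_basis_of_span (b (q + 1)) (c (q + 1)) (f (q + 1)) (hf (q + 1))
    (Module.finBasis ℤ (coboundaries dL (q + 1))) (Submodule.subtype _)
    (Submodule.subtype_injective _) (coboundaries dC (q + 1))
    (coboundaries_eq_span hdf b c hf (q + 1))
  obtain ⟨Z, -⟩ := exists_basis_of_span (b q) (c q) (f q) (hf q)
    (Module.finBasis ℤ (cocycles dL q)) (Submodule.subtype _)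
    (Submodule.subtype_injective _) _ rfl
  symm
  refine Submodule.eq_of_le_of_finrank_eq ?_ ?_
  · rw [Submodule.span_le]
    rintro _ ⟨x, rfl⟩
    have hx : dL q x = 0 := x.2
    change dC q (f q x) = 0
    rw [← hdf, hx, map_zero]
  · have h1 := Module.finrank_eq_card_basis Z
    have h2 : Module.finrank ℝ (LinearMap.range (dC q)) = _ := Module.finrank_eq_card_basis B
    have h3 := (dC q).finrank_range_add_finrank_ker
    have h4 := (LinearMap.ker (dL q)).finrank_quotient_add_finrank
    rw [(dL q).quotKerEquivRange.finrank_eq] at h4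
    have h5 := Module.finrank_eq_card_basis (b q)
    have h6 := Module.finrank_eq_card_basis (c q)
    rw [Fintype.card_fin] at h1 h2
    change Module.finrank ℝ (LinearMap.range (dC q))
      = Module.finrank ℤ (LinearMap.range (dL q)) at h2
    refine h1.trans ?_
    change Module.finrank ℤ (LinearMap.ker (dL q)) = Module.finrank ℝ (LinearMap.ker (dC q))
    omega

end Complexes

/-! ### Adapted bases in one degree -/

section SingleDegree

variable {L C : ℕ → Type*} [∀ q, AddCommGroup (L q)]
  [∀ q, AddCommGroup (C q)] [∀ q, Module ℝ (C q)]
  {dL : ∀ q, L q →ₗ[ℤ] L (q + 1)} {dC : ∀ q, C q →ₗ[ℝ] C (q + 1)} {f : ∀ q, L q →+ C q}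
  {I : ℕ → Type*}

theorem map_mem_cocycles (hdf : ∀ q x, f (q + 1) (dL q x) = dC q (f q x)) {q : ℕ} {x : L q}
    (hx : x ∈ cocycles dL q) : f q x ∈ cocycles dC q := by
  rw [LinearMap.mem_ker, ← hdf, LinearMap.mem_ker.1 hx, map_zero]

/-- The cocycles whose classes are torsion: the saturation of the coboundaries. -/
def torsionCocycles (dL : ∀ q, L q →ₗ[ℤ] L (q + 1)) (q : ℕ) : Submodule ℤ (cocycles dL q) :=
  (Submodule.torsion ℤ (Coh dL q)).comap ((coboundaries dL q).submoduleOf (cocycles dL q)).mkQ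

theorem submoduleOf_le_torsionCocycles (q : ℕ) :
    (coboundaries dL q).submoduleOf (cocycles dL q) ≤ torsionCocycles dL q := by
  intro x hx
  have : ((coboundaries dL q).submoduleOf (cocycles dL q)).mkQ x = 0 :=
    (Submodule.Quotient.mk_eq_zero _).2 hx
  change _ ∈ Submodule.torsion ℤ (Coh dL q)
  rw [this]
  exact zero_mem _

/-- The index of the coboundaries in their saturation is the order of the torsion of the
cohomology. -/
theorem card_torsionCocycles_quotient (q : ℕ) :
    Nat.card (torsionCocycles dL q ⧸
      ((coboundaries dL q).submoduleOf (cocycles dL q)).submoduleOf (torsionCocycles dL q)) =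
    Nat.card (Submodule.torsion ℤ (Coh dL q)) := by
  let φ : torsionCocycles dL q →ₗ[ℤ] Submodule.torsion ℤ (Coh dL q) :=
    ((coboundaries dL q).submoduleOf (cocycles dL q)).mkQ.restrict fun _ hx => hx
  have hφ : Function.Surjective φ := by
    rintro ⟨y, hy⟩
    obtain ⟨x, rfl⟩ := Submodule.mkQ_surjective _ y
    exact ⟨⟨x, hy⟩, rfl⟩
  have hker : LinearMap.ker φ =
      ((coboundaries dL q).submoduleOf (cocycles dL q)).submoduleOf (torsionCocycles dL q) := by
    ext x
    rw [LinearMap.mem_ker]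
    exact Subtype.ext_iff.trans (Submodule.Quotient.mk_eq_zero _)
  rw [← hker]
  exact Nat.card_congr (φ.quotKerEquivOfSurjective hφ).toEquiv

/-- A multiple of a cocycle with torsion class is a coboundary, so it is a real coboundary. -/
theorem map_torsionCocycle_mem (hdf : ∀ q x, f (q + 1) (dL q x) = dC q (f q x))
    (b : ∀ q, Module.Basis (I q) ℤ (L q)) (c : ∀ q, Module.Basis (I q) ℝ (C q))
    (hf : ∀ q i, f q (b q i) = c q i) {q : ℕ} (x : torsionCocycles dL q) :
    f q (x : cocycles dL q) ∈ coboundaries dC q := by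
  obtain ⟨k, hk⟩ := (Submodule.mem_torsion_iff _).1 x.2
  have h0 : ((k : ℤ) : ℝ) ≠ 0 := Int.cast_ne_zero.2 (nonZeroDivisors.ne_zero k.2)
  have h1 : (k : ℤ) • ((x : cocycles dL q) : L q) ∈ coboundaries dL q := by
    have h2 : ((coboundaries dL q).submoduleOf (cocycles dL q)).mkQ ((k : ℤ) • x.1) = 0 := by
      rw [map_smul]
      exact hk
    exact (Submodule.Quotient.mk_eq_zero
      ((coboundaries dL q).submoduleOf (cocycles dL q))).1 h2
  have h3 : f q ((k : ℤ) • ((x : cocycles dL q) : L q)) ∈ coboundaries dC q := by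
    rw [coboundaries_eq_span hdf b c hf q]
    exact Submodule.subset_span ⟨⟨_, h1⟩, rfl⟩
  rw [map_zsmul, ← Int.cast_smul_eq_zsmul ℝ] at h3
  exact (Submodule.smul_mem_iff _ h0).1 h3

/-- The volume of an adapted basis in one degree: apart from the volumes of the changes of basis of
the coboundaries and the cohomology, measured by integral bases, there remains the order of the
torsion of the integral cohomology. -/
theorem relVol_adaptedBasis [∀ q, FiniteDimensional ℝ (C q)] [∀ q, Fintype (I q)]
    [∀ q, DecidableEq (I q)]
    (hdL : ∀ q x, dL (q + 1) (dL q x) = 0) (hdC : ∀ q x, dC (q + 1) (dC q x) = 0)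
    (hdf : ∀ q x, f (q + 1) (dL q x) = dC q (f q x))
    (b : ∀ q, Module.Basis (I q) ℤ (L q)) (c : ∀ q, Module.Basis (I q) ℝ (C q))
    (hf : ∀ q i, f q (b q i) = c q i)
    {κ : ℕ → Type*} [∀ q, Fintype (κ q)] [∀ q, DecidableEq (κ q)]
    (β : ∀ q, Module.Basis (κ q) ℤ (coboundaries dL q))
    (βR : ∀ q, Module.Basis (κ q) ℝ (coboundaries dC q))
    (hβ : ∀ q k, (βR q k : C q) = f q (β q k)) (q : ℕ)
    (j : (Coh dL q ⧸ Submodule.torsion ℤ (Coh dL q)) →+ Coh dC q)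
    (hj : ∀ z : cocycles dL q, j (Submodule.Quotient.mk (cohClass dL q z)) =
      cohClass dC q ⟨f q z, map_mem_cocycles hdf z.2⟩)
    {r : ℕ} (e : Module.Basis (Fin r) ℤ (Coh dL q ⧸ Submodule.torsion ℤ (Coh dL q))) :
    ∃ eR : Module.Basis (Fin r) ℝ (Coh dC q), (∀ k, eR k = j (e k)) ∧
      relVol (c q) (adaptedBasis dC q) = Nat.card (Submodule.torsion ℤ (Coh dL q)) *
        relVol (βR q) (Module.finBasis ℝ (coboundaries dC q)) *
        relVol eR (Module.finBasis ℝ (Coh dC q)) *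
        relVol (βR (q + 1)) (Module.finBasis ℝ (coboundaries dC (q + 1))) := by
  have hfree : Module.Free ℤ (L q) := Module.Free.of_basis (b q)
  have hfin : Module.Finite ℤ (L q) := Module.Finite.of_basis (b q)
  -- an integral basis of the cocycles: torsion cocycles, then lifts of the basis `e`
  let S := torsionCocycles dL q
  let bS := Module.finBasis ℤ S
  let pH : cocycles dL q →ₗ[ℤ] (Coh dL q ⧸ Submodule.torsion ℤ (Coh dL q)) :=
    (Submodule.torsion ℤ (Coh dL q)).mkQ ∘ₗ
      ((coboundaries dL q).submoduleOf (cocycles dL q)).mkQ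
  have hpH : Function.Surjective pH :=
    (Submodule.mkQ_surjective _).comp (Submodule.mkQ_surjective _)
  have hpS : ∀ x : cocycles dL q, pH x = 0 ↔ x ∈ S := fun x =>
    Submodule.Quotient.mk_eq_zero _
  choose hl hhl using fun k => hpH (e k)
  obtain ⟨ζ, hζ⟩ := exists_basis_of_exact S.subtype pH (Submodule.subtype_injective _)
    (by
      intro x hx
      rw [Submodule.range_subtype]
      exact (hpS x).1 hx) (fun u => (hpS _).2 u.2) bS e hl hhl
  -- an integral basis of the cochains: cocycles, then lifts of the basis `β (q + 1)`
  choose ll hll using fun k => LinearMap.mem_range.1 (β (q + 1) k).2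
  obtain ⟨a, ha⟩ := exists_basis_of_exact (cocycles dL q).subtype (dL q).rangeRestrict
    (Submodule.subtype_injective _)
    (by rw [LinearMap.ker_rangeRestrict, Submodule.range_subtype])
    (fun u => Subtype.ext u.2) ζ (β (q + 1)) ll (fun k => Subtype.ext (hll k))
  -- the corresponding real bases
  obtain ⟨ζR, hζR⟩ := exists_basis_of_span (b q) (c q) (f q) (hf q) ζ (cocycles dL q).subtype
    (Submodule.subtype_injective _) (cocycles dC q) (cocycles_eq_span hdf b c hf q)
  obtain ⟨sR, hsR⟩ := exists_basis_of_span (b q) (c q) (f q) (hf q) bS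
    ((cocycles dL q).subtype ∘ₗ S.subtype)
    ((Submodule.subtype_injective _).comp (Submodule.subtype_injective _)) (coboundaries dC q)
    (by
      refine le_antisymm ?_ (Submodule.span_le.2 ?_)
      · rw [coboundaries_eq_span hdf b c hf q]
        refine Submodule.span_mono ?_
        rintro _ ⟨x, rfl⟩
        exact ⟨⟨⟨x, coboundaries_le_cocycles dL hdL q x.2⟩,
          submoduleOf_le_torsionCocycles q x.2⟩, rfl⟩
      · rintro _ ⟨x, rfl⟩
        exact map_torsionCocycle_mem hdf b c hf x)
  have hllR : ∀ k, dC q (f q (ll k)) = (βR (q + 1) k : C (q + 1)) := fun k => by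
    rw [hβ, ← hll, hdf]
  obtain ⟨aR, haR⟩ := exists_basis_of_exact (cocycles dC q).subtype (dC q).rangeRestrict
    (Submodule.subtype_injective _)
    (by rw [LinearMap.ker_rangeRestrict, Submodule.range_subtype])
    (fun u => Subtype.ext u.2) ζR (βR (q + 1)) (fun k => f q (ll k))
    (fun k => Subtype.ext (hllR k))
  have haaR : ∀ k, aR k = f q (a k) := by
    intro k
    rw [haR, ha]
    rcases k with k | k
    · exact hζR k
    · rfl
  -- the images of the elements of `e` form a basis of the real cohomology
  let B := (coboundaries dC q).submoduleOf (cocycles dC q)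
  have hBle := coboundaries_le_cocycles dC hdC q
  have hζl : ∀ k, ζR (Sum.inl k) = Submodule.inclusion hBle (sR k) := fun k => Subtype.ext (by
    rw [hζR, hζ, Submodule.coe_inclusion, hsR]; rfl)
  have hinc : ∀ u, B.mkQ (Submodule.inclusion hBle u) = 0 := fun u =>
    (Submodule.Quotient.mk_eq_zero _).2 u.2
  have hζr : ∀ k, B.mkQ (ζR (Sum.inr k)) = j (e k) := fun k => by
    rw [← hhl k]
    refine Eq.trans ?_ (hj (hl k)).symm
    refine congrArg B.mkQ (Subtype.ext ?_)
    rw [hζR, hζ]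
    rfl
  have hspan : ⊤ ≤ Submodule.span ℝ (range fun k => j (e k)) := by
    have h1 : (⊤ : Submodule ℝ (Coh dC q)) = LinearMap.range B.mkQ := by
      rw [Submodule.range_mkQ]
    rw [h1, LinearMap.range_eq_map, ← ζR.span_eq, Submodule.map_span_le]
    rintro _ ⟨k | k, rfl⟩
    · rw [hζl, hinc]
      exact zero_mem _
    · rw [hζr]
      exact Submodule.subset_span ⟨k, rfl⟩
  have hcard : Fintype.card (Fin r) = Module.finrank ℝ (Coh dC q) := by
    have h1 : Module.finrank ℝ (Coh dC q) + Module.finrank ℝ B = _ :=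
      B.finrank_quotient_add_finrank
    have h2 := (Submodule.submoduleOfEquivOfLe hBle).finrank_eq
    change Module.finrank ℝ B = _ at h2
    rw [h2, Module.finrank_eq_card_basis sR, Module.finrank_eq_card_basis ζR,
      Fintype.card_sum] at h1
    omega
  let eR := basisOfTopLeSpanOfCardEqFinrank _ hspan hcard
  have heR : ∀ k, eR k = j (e k) := fun k =>
    congrFun (coe_basisOfTopLeSpanOfCardEqFinrank _ hspan hcard) k
  refine ⟨eR, heR, ?_⟩
  -- the volumes
  have v1 : relVol (c q) aR = 1 := by
    have h1 := relVol_eq_card_quotient (b q) (c q) (f q) (hf q) ⊤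
      (a.map (Submodule.topEquiv).symm) (Fintype.card_congr ((c q).indexEquiv aR)).symm
    have h2 : (aR : _ → C q) = fun k => f q (a k) := funext haaR
    rw [h2]
    simpa using h1
  have v2 : relVol sR (βR q) = Nat.card (Submodule.torsion ℤ (Coh dL q)) := by
    let fS : S →+ coboundaries dC q :=
      { toFun := fun x => ⟨f q (x : cocycles dL q), map_torsionCocycle_mem hdf b c hf x⟩
        map_zero' := Subtype.ext (map_zero (f q))
        map_add' := fun x y => Subtype.ext (map_add (f q) _ _) }
    have h1 := relVol_eq_card_quotient bS sR fS (fun k => Subtype.ext (hsR k).symm)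
      (((coboundaries dL q).submoduleOf (cocycles dL q)).submoduleOf S)
      (((β q).map (Submodule.submoduleOfEquivOfLe (coboundaries_le_cocycles dL hdL q)).symm).map
        (Submodule.submoduleOfEquivOfLe (submoduleOf_le_torsionCocycles q)).symm)
      (Fintype.card_congr (sR.indexEquiv (βR q))).symm
    rw [card_torsionCocycles_quotient] at h1
    rw [← h1]
    congr 1
    funext k
    refine Subtype.ext ?_
    rw [hβ]
    rfl
  have c1 : Module.finrank ℝ (coboundaries dC q) = Module.finrank ℤ S := by
    rw [Module.finrank_eq_card_basis sR, Fintype.card_fin]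
  have c2 : Module.finrank ℝ (Coh dC q) = r := by
    rw [← hcard, Fintype.card_fin]
  have c3 : Module.finrank ℝ (coboundaries dC (q + 1)) = Fintype.card (κ (q + 1)) :=
    Module.finrank_eq_card_basis (βR (q + 1))
  let zf : Fin (Module.finrank ℝ (coboundaries dC q)) ⊕ Fin (Module.finrank ℝ (Coh dC q)) →
      cocycles dC q :=
    Sum.elim (fun i => Submodule.inclusion hBle (Module.finBasis ℝ (coboundaries dC q) i))
      (fun i => Quotient.out (Module.finBasis ℝ (Coh dC q) i))
  have v3 : relVol ζR zf = relVol sR (Module.finBasis ℝ (coboundaries dC q)) *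
      relVol eR (Module.finBasis ℝ (Coh dC q)) :=
    relVol_of_exact (Submodule.inclusion hBle) B.mkQ hinc sR eR ζR hζl
      (fun k => (hζr k).trans (heR k).symm) _ _ zf (fun _ => rfl)
      (fun k => Quotient.out_eq _) (by simp [c1]) (by simp [c2])
  have v4 : relVol aR (adaptedBasis dC q ∘ Equiv.sumAssoc _ _ _) = relVol ζR zf *
      relVol (βR (q + 1)) (Module.finBasis ℝ (coboundaries dC (q + 1))) := by
    refine relVol_of_exact (cocycles dC q).subtype (dC q).rangeRestrict
      (fun u => Subtype.ext u.2) ζR (βR (q + 1)) aR (fun k => by rw [haR]; rfl)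
      (fun k => ?_) zf _ _ ?_ (fun k => ?_) (by simp [c1, c2]) (by simp [c3])
    · rw [haR]
      exact Subtype.ext (hllR k)
    · rintro (k | k) <;> rfl
    · refine Subtype.ext ?_
      exact Classical.choose_spec (LinearMap.mem_range.1
        (Module.finBasis ℝ (coboundaries dC (q + 1)) k).2)
  have hcc : Fintype.card (Fin (Module.finrank ℝ (coboundaries dC q)) ⊕
      (Fin (Module.finrank ℝ (Coh dC q)) ⊕
        Fin (Module.finrank ℝ (coboundaries dC (q + 1))))) = Fintype.card (I q) := by
    rw [Fintype.card_congr ((c q).indexEquiv aR)]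
    simp [c1, c2, c3, add_assoc]
  rw [relVol_comp_equiv] at v4
  rw [relVol_mul (c q) aR _ hcc, v1, v4, v3,
    relVol_mul sR (βR q) (Module.finBasis ℝ (coboundaries dC q)) (by simp [c1]), v2]
  ring

end SingleDegree

/-! ### The torsion of a complex with an integral structure -/

section TorsionFormula

theorem relVol_eq_one_of_subsingleton {W I J : Type*} [AddCommGroup W] [Module ℝ W] [Fintype I]
    [Fintype J] [DecidableEq J] [Subsingleton W] (c : Module.Basis I ℝ W)
    (v : Module.Basis J ℝ W) : relVol c v = 1 := by
  have : IsEmpty J := ⟨fun j => v.ne_zero j (Subsingleton.elim _ _)⟩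
  unfold relVol
  simp

/-- The alternating product of consecutive terms telescopes. -/
theorem prod_mul_succ_zpow (x : ℕ → ℝ) (hx : ∀ q, x q ≠ 0) (m : ℕ) :
    ∏ q ∈ Finset.range m, (x q * x (q + 1)) ^ ((-1 : ℤ) ^ (q + 1)) =
      (x 0)⁻¹ * x m ^ ((-1 : ℤ) ^ m) := by
  induction m with
  | zero => simp [hx 0]
  | succ m ih =>
    rw [Finset.prod_range_succ, ih, mul_zpow, mul_assoc, ← mul_assoc (x m ^ _), ← zpow_add₀ (hx m)]
    rw [pow_succ (-1 : ℤ) m]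
    simp

variable {L C : ℕ → Type*} [∀ q, AddCommGroup (L q)]
  [∀ q, AddCommGroup (C q)] [∀ q, Module ℝ (C q)] [∀ q, FiniteDimensional ℝ (C q)]
  {dL : ∀ q, L q →ₗ[ℤ] L (q + 1)} {dC : ∀ q, C q →ₗ[ℝ] C (q + 1)} {f : ∀ q, L q →+ C q}
  {I : ℕ → Type*} [∀ q, Fintype (I q)] {I' : ℕ → Type*} [∀ q, Fintype (I' q)]

/-- The torsion of a real cochain complex with an integral structure: it is the regulator of the free
part of the integral cohomology times the alternating product of the orders of the torsion parts,
up to the volumes `δ q` of the integral bases with respect to the given ones. -/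
theorem torsion_eq_of_lattice (n : ℕ) (hn : Subsingleton (C (n + 1)))
    (hdL : ∀ q x, dL (q + 1) (dL q x) = 0) (hdC : ∀ q x, dC (q + 1) (dC q x) = 0)
    (hdf : ∀ q x, f (q + 1) (dL q x) = dC q (f q x))
    (b : ∀ q, Module.Basis (I q) ℤ (L q)) (c : ∀ q, Module.Basis (I q) ℝ (C q))
    (hf : ∀ q i, f q (b q i) = c q i) (c' : ∀ q, Module.Basis (I' q) ℝ (C q))
    (δ : ℕ → ℝ) (hδ : ∀ q [DecidableEq (I q)], relVol (c' q) (c q) = δ q)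
    (j : ∀ q, (Coh dL q ⧸ Submodule.torsion ℤ (Coh dL q)) →+ Coh dC q)
    (hj : ∀ q (z : cocycles dL q), j q (Submodule.Quotient.mk (cohClass dL q z)) =
      cohClass dC q ⟨f q z, map_mem_cocycles hdf z.2⟩)
    {r : ℕ → ℕ}
    (e : ∀ q, Module.Basis (Fin (r q)) ℤ (Coh dL q ⧸ Submodule.torsion ℤ (Coh dL q)))
    (B : ∀ q, LinearMap.BilinForm ℝ (Coh dC q)) :
    torsion n dC c' (fun q => gramVol (fun x y => B q x y)) =
      (∏ q ∈ Finset.range (n + 1), δ q ^ ((-1 : ℤ) ^ (q + 1))) *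
      ((∏ q ∈ Finset.range (n + 1),
        gramVol (fun x y => B q x y) (fun k => j q (e q k)) ^ ((-1 : ℤ) ^ q)) *
        ∏ q ∈ Finset.range (n + 1),
          (Nat.card (Submodule.torsion ℤ (Coh dL q)) : ℝ) ^ ((-1 : ℤ) ^ (q + 1))) := by
  classical
  have hfree : ∀ q, Module.Free ℤ (L q) := fun q => Module.Free.of_basis (b q)
  have hfin : ∀ q, Module.Finite ℤ (L q) := fun q => Module.Finite.of_basis (b q)
  let β := fun q => Module.finBasis ℤ (coboundaries dL q)
  choose βR hβ using fun q => exists_basis_of_span (b q) (c q) (f q) (hf q) (β q)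
    (coboundaries dL q).subtype (Submodule.subtype_injective _) (coboundaries dC q)
    (coboundaries_eq_span hdf b c hf q)
  choose eR heR hvol using fun q =>
    relVol_adaptedBasis hdL hdC hdf b c hf β βR hβ q (j q) (hj q) (e q)
  let x : ℕ → ℝ := fun q => relVol (βR q) (Module.finBasis ℝ (coboundaries dC q))
  have hx : ∀ q, x q ≠ 0 := fun q => relVol_ne_zero _ _
  have hx0 : x 0 = 1 := by
    have : Subsingleton (coboundaries dC 0) :=
      inferInstanceAs (Subsingleton (⊥ : Submodule ℝ (C 0)))
    exact relVol_eq_one_of_subsingleton _ _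
  have hxn : x (n + 1) = 1 := relVol_eq_one_of_subsingleton _ _
  have htel := prod_mul_succ_zpow x hx (n + 1)
  rw [hx0, hxn, one_zpow, inv_one, one_mul] at htel
  have hterm : ∀ q, (relVol (c' q) (adaptedBasis dC q) /
        gramVol (fun x y => B q x y) (Module.finBasis ℝ (Coh dC q))) ^ ((-1 : ℤ) ^ (q + 1)) =
      δ q ^ ((-1 : ℤ) ^ (q + 1)) *
      (gramVol (fun x y => B q x y) (fun k => j q (e q k)) ^ ((-1 : ℤ) ^ q) *
        (Nat.card (Submodule.torsion ℤ (Coh dL q)) : ℝ) ^ ((-1 : ℤ) ^ (q + 1))) *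
      (x q * x (q + 1)) ^ ((-1 : ℤ) ^ (q + 1)) := by
    intro q
    have h1 := gramVol_eq_relVol_mul (B q) (eR q) (Module.finBasis ℝ (Coh dC q))
      (Fintype.card_congr ((eR q).indexEquiv (Module.finBasis ℝ (Coh dC q)))).symm
    have h2 : (eR q : _ → Coh dC q) = fun k => j q (e q k) := funext (heR q)
    have hne : relVol (eR q) (Module.finBasis ℝ (Coh dC q)) ≠ 0 := relVol_ne_zero _ _
    have hcard : Fintype.card (Fin (Module.finrank ℝ (coboundaries dC q)) ⊕
        (Fin (Module.finrank ℝ (Coh dC q)) ⊕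
          Fin (Module.finrank ℝ (coboundaries dC (q + 1))))) = Fintype.card (I' q) := by
      have h3 := (dC q).finrank_range_add_finrank_ker
      have h4 := ((coboundaries dC q).submoduleOf (cocycles dC q)).finrank_quotient_add_finrank
      have h5 := (Submodule.submoduleOfEquivOfLe (coboundaries_le_cocycles dC hdC q)).finrank_eq
      have h6 := Module.finrank_eq_card_basis (c' q)
      change Module.finrank ℝ (coboundaries dC (q + 1)) + Module.finrank ℝ (cocycles dC q) = _
        at h3
      change Module.finrank ℝ (Coh dC q) + _ = _ at h4
      rw [h5] at h4
      simp only [Fintype.card_sum, Fintype.card_fin]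
      omega
    rw [h1, h2, relVol_mul (c' q) (c q) _ hcard, hδ, hvol q]
    have h7 : δ q * (Nat.card (Submodule.torsion ℤ (Coh dL q)) *
        relVol (βR q) (Module.finBasis ℝ (coboundaries dC q)) *
        relVol (eR q) (Module.finBasis ℝ (Coh dC q)) *
        relVol (βR (q + 1)) (Module.finBasis ℝ (coboundaries dC (q + 1)))) /
        (relVol (eR q) (Module.finBasis ℝ (Coh dC q)) *
          gramVol (fun x y => B q x y) (fun k => j q (e q k))) =
        δ q * ((gramVol (fun x y => B q x y) (fun k => j q (e q k)))⁻¹ *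
          Nat.card (Submodule.torsion ℤ (Coh dL q))) * (x q * x (q + 1)) := by
      change δ q * (_ * x q * _ * x (q + 1)) / _ = _
      rw [div_eq_mul_inv, mul_inv]
      field_simp
    have h8 : -((-1 : ℤ) ^ (q + 1)) = (-1) ^ q := by rw [pow_succ]; ring
    rw [h7, mul_zpow, mul_zpow, mul_zpow, inv_zpow', h8]
  unfold torsion
  rw [Finset.prod_congr rfl fun q _ => hterm q, Finset.prod_mul_distrib, htel, mul_one,
    Finset.prod_mul_distrib, Finset.prod_mul_distrib]

end TorsionFormula

/-! ### Faces of faces -/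

section Simplices

variable {ι : Type*} [LinearOrder ι]

theorem Simplex.vertex_face {K : AbstractSimplicialComplex ι} {q : ℕ} (s : Simplex K (q + 1))
    (i : Fin (q + 2)) (j : Fin (q + 1)) : (s.face i).vertex j = s.vertex (i.succAbove j) := by
  refine (congrFun (Finset.orderEmbOfFin_unique (s.face i).2.2
    (f := fun j => s.vertex (i.succAbove j)) (fun j => ?_) ?_) j).symm
  · refine Finset.mem_erase.2 ⟨fun h => ?_, s.vertex_mem _⟩
    exact Fin.succAbove_ne i j ((s.1.orderEmbOfFin s.2.2).injective h)
  · exact (s.1.orderEmbOfFin s.2.2).strictMono.comp (Fin.strictMono_succAbove i)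

theorem Simplex.face_face {K : AbstractSimplicialComplex ι} {q : ℕ} (s : Simplex K (q + 2))
    (i : Fin (q + 3)) (j : Fin (q + 2)) (i' : Fin (q + 3)) (j' : Fin (q + 2))
    (h₁ : i.succAbove j = i') (h₂ : i'.succAbove j' = i) :
    (s.face i).face j = (s.face i').face j' := by
  refine Subtype.ext ?_
  change (s.1.erase (s.vertex i)).erase ((s.face i).vertex j)
    = (s.1.erase (s.vertex i')).erase ((s.face i').vertex j')
  rw [s.vertex_face, s.vertex_face, h₁, h₂, Finset.erase_right_comm]

theorem Simplex.face_subset {K : AbstractSimplicialComplex ι} {q : ℕ} (s : Simplex K (q + 1))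
    (i : Fin (q + 2)) : (s.face i).1 ⊆ s.1 :=
  Finset.erase_subset _ _

/-- The involution of the pairs `(i, j)` that exchanges the two orders in which a pair of vertices
can be removed. -/
def facePairSwap {q : ℕ} (x : Fin (q + 3) × Fin (q + 2)) : Fin (q + 3) × Fin (q + 2) :=
  if h : (x.2 : ℕ) < x.1 then (x.2.castSucc, ⟨x.1 - 1, by omega⟩)
  else (x.2.succ, ⟨x.1, by omega⟩)

theorem facePairSwap_facePairSwap {q : ℕ} (x : Fin (q + 3) × Fin (q + 2)) :
    facePairSwap (facePairSwap x) = x := by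
  obtain ⟨i, j⟩ := x
  unfold facePairSwap
  by_cases h : (j : ℕ) < i
  · have h2 : ¬ ((i : ℕ) - 1 < j) := by omega
    simp only [h, dite_true, Fin.val_castSucc, h2, dite_false]
    refine Prod.ext (Fin.ext ?_) (Fin.ext ?_)
    · simp; omega
    · simp
  · have h2 : (i : ℕ) < j + 1 := by omega
    simp only [h, dite_false, Fin.val_succ, h2, dite_true]
    refine Prod.ext (Fin.ext ?_) (Fin.ext ?_) <;> simp

theorem succAbove_facePairSwap {q : ℕ} (x : Fin (q + 3) × Fin (q + 2)) :
    x.1.succAbove x.2 = (facePairSwap x).1 := by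
  obtain ⟨i, j⟩ := x
  unfold facePairSwap
  by_cases h : (j : ℕ) < i
  · simp only [h, dite_true]
    exact Fin.succAbove_of_castSucc_lt _ _ (Fin.lt_def.2 h)
  · simp only [h, dite_false]
    exact Fin.succAbove_of_le_castSucc _ _ (Fin.le_def.2 (not_lt.1 h))

theorem neg_one_pow_facePairSwap {R : Type*} [CommRing R] {q : ℕ} (x : Fin (q + 3) × Fin (q + 2)) :
    (-1 : R) ^ ((x.1 : ℕ) + x.2) = - (-1 : R) ^ (((facePairSwap x).1 : ℕ) + (facePairSwap x).2) := by
  obtain ⟨i, j⟩ := x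
  unfold facePairSwap
  by_cases h : (j : ℕ) < i
  · have h2 : (i : ℕ) + j = (j + (i - 1)) + 1 := by omega
    simp only [h, dite_true, Fin.val_castSucc]
    rw [h2, pow_succ]
    ring
  · simp only [h, dite_false, Fin.val_succ]
    rw [show (j : ℕ) + 1 + i = (i + j) + 1 by omega, pow_succ]
    ring

end Simplices

/-! ### The twisted cochain complex of a triangulation -/

section TwistedComplex

variable {n : ℕ} {X : Type*} [TopologicalSpace X] [ChartedSpace (EuclideanSpace ℝ (Fin n)) X]
  {x₀ : X} {R W : Type*} [CommRing R] [AddCommGroup W] [Module R W]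
  {ι : Type*} [LinearOrder ι] [Fintype ι]

/-- Two consecutive segments in a simplex are homotopic to a single one, because a simplex is
contractible. -/
theorem SmoothTriangulation.segment_trans_segment (K : SmoothTriangulation n X ι) {q q' : ℕ}
    (s : Simplex K.complex q) (t : Simplex K.complex q') {x y z : ι → ℝ}
    (hx : x ∈ closedFace s.1) (hy : y ∈ closedFace s.1) (hz : z ∈ closedFace s.1)
    (hy' : y ∈ closedFace t.1) (hz' : z ∈ closedFace t.1) :
    (Path.Homotopic.Quotient.mk (K.segment s hx hy)).trans (.mk (K.segment t hy' hz')) =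
      .mk (K.segment s hx hz) := by
  have : ContractibleSpace (closedFace s.1) :=
    (convex_closedFace s.1).contractibleSpace ⟨x, hx⟩
  let F : closedFace s.1 → X := fun u => K.map u
  have hF : Continuous F := K.continuousOn.comp_continuous continuous_subtype_val
    (fun u => mem_biUnion s.2.1 u.2)
  let line : ∀ u v : closedFace s.1, Path u v := fun u v =>
    { toFun := fun r => ⟨AffineMap.lineMap (u : ι → ℝ) (v : ι → ℝ) (r : ℝ),
        (convex_closedFace s.1).segment_subset u.2 v.2 (lineMap_mem_segment ℝ _ _ r.2)⟩
      continuous_toFun := by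
        refine Continuous.subtype_mk ?_ _
        exact AffineMap.lineMap_continuous.comp continuous_subtype_val
      source' := by simp
      target' := by simp }
  have h1 : ((line ⟨x, hx⟩ ⟨y, hy⟩).trans (line ⟨y, hy⟩ ⟨z, hz⟩)).Homotopic
      (line ⟨x, hx⟩ ⟨z, hz⟩) := SimplyConnectedSpace.paths_homotopic _ _
  have h2 := h1.map ⟨F, hF⟩
  rw [Path.map_trans] at h2
  exact Quotient.sound h2

/-- The twisted coboundary squares to zero. -/
theorem coboundary_coboundary (K : SmoothTriangulation n X ι)
    (ρ : Representation R (FundamentalGroup X x₀) W) (q : ℕ) (c : Cochain K ρ q) :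
    coboundary K ρ (q + 1) (coboundary K ρ q c) = 0 := by
  funext s
  refine Subtype.ext (funext fun p => ?_)
  -- the value of `c` on a face `σ` of `s`, transported to the first vertex of `s`
  let T : ∀ σ : Simplex K.complex q, σ.1 ⊆ s.1 → W := fun σ hσ =>
    (c σ).1 (p.trans (.mk (K.segment s (single_mem_closedFace (s.vertex_mem 0))
      (single_mem_closedFace (hσ (σ.vertex_mem 0))))))
  have hsub : ∀ i j, ((s.face i).face j).1 ⊆ s.1 := fun i j =>
    ((s.face i).face_subset j).trans (s.face_subset i)
  have hterm : (coboundary K ρ (q + 1) (coboundary K ρ q c) s).1 p =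
      ∑ i : Fin (q + 3), ∑ j : Fin (q + 2),
        (-1 : R) ^ ((i : ℕ) + j) • T ((s.face i).face j) (hsub i j) := by
    change ∑ i : Fin (q + 1 + 2), (-1 : R) ^ (i : ℕ) • (∑ j : Fin (q + 2), (-1 : R) ^ (j : ℕ) •
      (c ((s.face i).face j)).1 ((p.trans (.mk (K.edge s i))).trans
        (.mk (K.edge (s.face i) j)))) = _
    refine Finset.sum_congr rfl fun i _ => ?_
    rw [Finset.smul_sum]
    refine Finset.sum_congr rfl fun j _ => ?_
    rw [smul_smul, ← pow_add, trans_assoc']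
    refine congrArg (fun v => (-1 : R) ^ ((i : ℕ) + j) • v) ?_
    exact congrArg (fun a => (c ((s.face i).face j)).1 (p.trans a))
      (K.segment_trans_segment s (s.face i) _ _ _ _ _)
  rw [hterm, ← Fintype.sum_prod_type']
  have hT : ∀ x : Fin (q + 3) × Fin (q + 2), T ((s.face x.1).face x.2) (hsub _ _) =
      T ((s.face (facePairSwap x).1).face (facePairSwap x).2) (hsub _ _) := by
    intro x
    have hTc : ∀ σ σ' (h : σ = σ') hσ hσ', T σ hσ = T σ' hσ' := by
      rintro σ _ rfl _ _
      rfl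
    exact hTc _ _ (s.face_face x.1 x.2 (facePairSwap x).1 (facePairSwap x).2
      (succAbove_facePairSwap x) (by rw [succAbove_facePairSwap, facePairSwap_facePairSwap]))
      (hsub _ _) (hsub _ _)
  refine Finset.sum_involution (fun x _ => facePairSwap x) (fun x _ => ?_) (fun x _ _ hx => ?_)
    (fun _ _ => Finset.mem_univ _) (fun x _ => facePairSwap_facePairSwap x)
  · rw [neg_one_pow_facePairSwap x, hT x, neg_smul, neg_add_cancel]
  · have h1 := succAbove_facePairSwap x
    rw [hx] at h1
    exact Fin.succAbove_ne _ _ h1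

/-- A smooth triangulation of an `n`-manifold has no simplices of dimension above `n`, since the
simplices are immersed. -/
theorem SmoothTriangulation.le_of_simplex (K : SmoothTriangulation n X ι) {q : ℕ}
    (s : Simplex K.complex q) : q ≤ n := by
  have h := K.immersive q s 0 ⟨fun _ => le_rfl, by simp⟩
  have : FiniteDimensional ℝ (TangentSpace (𝓡 n) (K.map (s.bary 0))) :=
    inferInstanceAs (FiniteDimensional ℝ (EuclideanSpace ℝ (Fin n)))
  have h2 := LinearMap.finrank_le_finrank_of_injective
    (f := (mfderivWithin 𝓘(ℝ, Fin q → ℝ) (𝓡 n) (fun t => K.map (s.bary t)) (paramSimplex q)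
      0).toLinearMap) h
  have h3 : Module.finrank ℝ (TangentSpace (𝓡 n) (K.map (s.bary 0))) = n :=
    finrank_euclideanSpace_fin (𝕜 := ℝ)
  have h4 : Module.finrank ℝ (TangentSpace 𝓘(ℝ, Fin q → ℝ) (0 : Fin q → ℝ)) = q :=
    Module.finrank_fin_fun (R := ℝ)
  rw [h3, h4] at h2
  exact h2

variable {V κ : Type*} [AddCommGroup V] [Module ℝ V]

/-- The basis `σ_j ⊗ m_k` of the `M`-valued cochains given by a basis of `M` and lifts of the
simplices. -/
noncomputable def latticeCochainBasis (K : SmoothTriangulation n X ι)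
    (ρ : Representation ℝ (FundamentalGroup X x₀) V) (M : Submodule ℤ V)
    (hM : ∀ γ, ∀ m ∈ M, ρ γ m ∈ M) (b : Module.Basis κ ℤ M)
    (w : ∀ (q : ℕ) (s : Simplex K.complex q), PathClass x₀ (K.vert s)) (q : ℕ) :
    Module.Basis (Σ _ : Simplex K.complex q, κ) ℤ (Cochain K (latticeRep ρ M hM) q) :=
  (Pi.basis fun _ => b).map
    (LinearEquiv.piCongrRight fun s => (Fibre.evalEquiv (latticeRep ρ M hM) (w q s)).symm)

theorem cochainIncl_latticeCochainBasis (K : SmoothTriangulation n X ι)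
    (ρ : Representation ℝ (FundamentalGroup X x₀) V) (M : Submodule ℤ V)
    (hM : ∀ γ, ∀ m ∈ M, ρ γ m ∈ M) (b : Module.Basis κ ℤ M) (θ : Module.Basis κ ℝ V)
    (hbθ : ∀ k, θ k = b k)
    (w : ∀ (q : ℕ) (s : Simplex K.complex q), PathClass x₀ (K.vert s)) (q : ℕ)
    (i : Σ _ : Simplex K.complex q, κ) :
    cochainIncl K ρ M hM q (latticeCochainBasis K ρ M hM b w q i) = cochainBasis K ρ θ w q i := by
  classical
  obtain ⟨s, k⟩ := i
  funext t
  refine Subtype.ext (funext fun p => ?_)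
  unfold latticeCochainBasis cochainBasis
  rw [Module.Basis.map_apply, Module.Basis.map_apply, Pi.basis_apply, Pi.basis_apply]
  change ((latticeRep ρ M hM (between (w q t) p)
    ((Pi.single s (b k) : Simplex K.complex q → M) t) : M) : V)
    = ρ (between (w q t) p) ((Pi.single s (θ k) : Simplex K.complex q → V) t)
  rcases eq_or_ne t s with rfl | h
  · rw [Pi.single_eq_same, Pi.single_eq_same, hbθ]
    rfl
  · rw [Pi.single_eq_of_ne h, Pi.single_eq_of_ne h, map_zero, map_zero]
    rfl

/-- Changing the basis of `V` multiplies the volume of the `q`-cochains by the determinant to the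
power of the number of `q`-simplices. -/
theorem relVol_cochainBasis [Fintype κ] [DecidableEq κ] (K : SmoothTriangulation n X ι)
    (ρ : Representation ℝ (FundamentalGroup X x₀) V) (θ θ' : Module.Basis κ ℝ V)
    (w : ∀ (q : ℕ) (s : Simplex K.complex q), PathClass x₀ (K.vert s)) (q : ℕ)
    [DecidableEq (Σ _ : Simplex K.complex q, κ)] :
    relVol (cochainBasis K ρ θ w q) (cochainBasis K ρ θ' w q) =
      |θ.det θ'| ^ Nat.card (Simplex K.complex q) := by
  rw [relVol_eq_abs_det _ _ (Equiv.refl _), ← abs_pow]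
  congr 1
  let τ : (Σ _ : Simplex K.complex q, κ) ≃ κ × Simplex K.complex q :=
    (Equiv.sigmaEquivProd _ _).trans (Equiv.prodComm _ _)
  have key : (cochainBasis K ρ θ w q).toMatrix (cochainBasis K ρ θ' w q ∘ Equiv.refl _) =
      (Matrix.blockDiagonal fun _ : Simplex K.complex q => θ.toMatrix θ').submatrix τ τ := by
    ext ⟨s, k⟩ ⟨t, l⟩
    simp only [Module.Basis.toMatrix_apply, Function.comp_apply, Equiv.refl_apply,
      Matrix.submatrix_apply, Matrix.blockDiagonal_apply]
    unfold cochainBasis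
    rw [Module.Basis.map_repr, LinearEquiv.trans_apply, Module.Basis.map_apply,
      LinearEquiv.symm_apply_apply, Pi.basis_apply, Pi.basis_repr]
    change θ.repr ((Pi.single t (θ' l) : Simplex K.complex q → V) s) k =
      if s = t then θ.repr (θ' l) k else 0
    split_ifs with h
    · rw [h, Pi.single_eq_same]
    · rw [Pi.single_eq_of_ne h, map_zero]
      rfl
  rw [Module.Basis.det_apply, key, Matrix.det_submatrix_equiv_self, Matrix.det_blockDiagonal,
    Finset.prod_const, Finset.card_univ, Nat.card_eq_fintype_card, Module.Basis.det_apply]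

end TwistedComplex

/-! ### The Riemannian metric in coordinates -/

section CoordinateVectors

variable {n : ℕ} {X : Type*} [TopologicalSpace X] [ChartedSpace (EuclideanSpace ℝ (Fin n)) X]
  [IsManifold (𝓡 n) ∞ X]

theorem mfderiv_extChartAt_coordVec (i : X) {y : EuclideanSpace ℝ (Fin n)}
    (hy : y ∈ (extChartAt (𝓡 n) i).target) (k : Fin n) :
    mfderiv (𝓡 n) 𝓘(ℝ, EuclideanSpace ℝ (Fin n)) (extChartAt (𝓡 n) i)
      ((extChartAt (𝓡 n) i).symm y) (coordVec i y k) = EuclideanSpace.single k (1 : ℝ) := by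
  have h := mfderiv_extChartAt_comp_mfderivWithin_extChartAt_symm (I := 𝓡 n) hy
  rw [(𝓡 n).range_eq_univ, mfderivWithin_univ] at h
  exact congrArg (fun A => A (EuclideanSpace.single k (1 : ℝ))) h

/-- In the trivialization of the tangent bundle given by the chart, coordinate vector fields are
constant. -/
theorem contMDiffAt_coordVec (i : X) {y : EuclideanSpace ℝ (Fin n)}
    (hy : y ∈ (extChartAt (𝓡 n) i).target) (k : Fin n) :
    ContMDiffAt 𝓘(ℝ, EuclideanSpace ℝ (Fin n)) ((𝓡 n).prod 𝓘(ℝ, EuclideanSpace ℝ (Fin n))) 0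
      (fun z => (⟨(extChartAt (𝓡 n) i).symm z, coordVec i z k⟩ :
        Bundle.TotalSpace (EuclideanSpace ℝ (Fin n)) (TangentSpace (𝓡 n) : X → Type _))) y := by
  have htarget : (extChartAt (𝓡 n) i).target ∈ 𝓝 y :=
    (isOpen_extChartAt_target i).mem_nhds hy
  have hmem : ∀ z ∈ (extChartAt (𝓡 n) i).target,
      (extChartAt (𝓡 n) i).symm z ∈ (chartAt (EuclideanSpace ℝ (Fin n)) i).source := by
    intro z hz
    rw [← extChartAt_source (𝓡 n)]
    exact (extChartAt (𝓡 n) i).map_target hz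
  rw [(trivializationAt (EuclideanSpace ℝ (Fin n)) (TangentSpace (𝓡 n) : X → Type _)
    i).contMDiffAt_iff]
  · refine ⟨?_, ?_⟩
    · exact ((contMDiffOn_extChartAt_symm (n := ∞) i).contMDiffAt htarget).of_le (by simp)
    · refine (contMDiffAt_const (c := EuclideanSpace.single k (1 : ℝ))).congr_of_eventuallyEq ?_
      filter_upwards [htarget] with z hz
      have h1 := congrArg (fun A => A (coordVec i z k))
        (TangentBundle.continuousLinearMapAt_trivializationAt (I := 𝓡 n) (hmem z hz))
      refine Eq.trans ?_ (h1.trans (mfderiv_extChartAt_coordVec i hz k))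
      refine Eq.symm (congrFun (Bundle.Trivialization.coe_linearMapAt_of_mem _ ?_) _)
      exact hmem z hz
  · rw [Bundle.Trivialization.mem_source]
    exact hmem y hy

theorem continuousOn_metricMatrix (g : Metric n X) (i : X) (k l : Fin n) :
    ContinuousOn (fun y => metricMatrix g i y k l) (extChartAt (𝓡 n) i).target := by
  intro y hy
  refine ContinuousAt.continuousWithinAt ?_
  have hv := contMDiffAt_coordVec i hy k
  have hw := contMDiffAt_coordVec i hy l
  have hb : ContMDiffAt 𝓘(ℝ, EuclideanSpace ℝ (Fin n)) (𝓡 n) 0 (extChartAt (𝓡 n) i).symm y :=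
    (Bundle.contMDiffAt_totalSpace.1 hv).1
  have hg := (g.contMDiff.of_le (show (0 : ℕ∞ω) ≤ ∞ by simp)).contMDiffAt
    (x := (extChartAt (𝓡 n) i).symm y)
  have h := ContMDiffAt.clm_bundle_apply₂ (F₁ := EuclideanSpace ℝ (Fin n))
    (F₂ := EuclideanSpace ℝ (Fin n)) (E₃ := Bundle.Trivial X ℝ) (F₃ := ℝ)
    (ψ := fun z => g.inner ((extChartAt (𝓡 n) i).symm z))
    (ContMDiffAt.comp y hg hb) hv hw
  exact (Bundle.contMDiffAt_totalSpace.1 h).2.continuousAt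

/-- A vector in the kernel of the metric matrix gives a tangent vector of length zero. -/
theorem det_metricMatrix_ne_zero (g : Metric n X) (i : X) {y : EuclideanSpace ℝ (Fin n)}
    (hy : y ∈ (extChartAt (𝓡 n) i).target) : (metricMatrix g i y).det ≠ 0 := by
  intro h
  obtain ⟨v, hv, hvA⟩ := Matrix.exists_mulVec_eq_zero_iff.2 h
  set u : TangentSpace (𝓡 n) ((extChartAt (𝓡 n) i).symm y) := ∑ k, v k • coordVec i y k with hu
  have hgu : g.inner _ u u = 0 := by
    have h1 : ∀ k, g.inner _ (coordVec i y k) u = 0 := fun k => by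
      have := congrFun hvA k
      rw [Matrix.mulVec, dotProduct] at this
      rw [hu, map_sum]
      simp only [map_smul, smul_eq_mul]
      rw [Pi.zero_apply] at this
      rw [← this]
      exact Finset.sum_congr rfl fun l _ => mul_comm _ _
    refine (congrArg (g.inner _ u) hu).trans ?_
    rw [map_sum]
    refine Finset.sum_eq_zero fun k _ => ?_
    rw [map_smul, g.symm, h1, smul_zero]
  have hu0 : u = 0 := by
    by_contra h0
    exact (g.pos _ u h0).ne' hgu
  have h2 := congrArg (mfderiv (𝓡 n) 𝓘(ℝ, EuclideanSpace ℝ (Fin n)) (extChartAt (𝓡 n) i)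
      ((extChartAt (𝓡 n) i).symm y)) hu0
  rw [hu, map_sum, map_zero] at h2
  simp only [map_smul, mfderiv_extChartAt_coordVec i hy] at h2
  refine hv (funext fun k => ?_)
  have h3 := congrArg (fun z : EuclideanSpace ℝ (Fin n) => z k) h2
  have h4 : (∑ l, v l • (EuclideanSpace.single l (1 : ℝ) : EuclideanSpace ℝ (Fin n))) k = 0 := h3
  simpa [Pi.single_apply] using h4

end CoordinateVectors

/-! ### The inner product of forms with values in the flat bundle -/

section FlatForms

variable {n : ℕ} {X : Type*} [TopologicalSpace X] [ChartedSpace (EuclideanSpace ℝ (Fin n)) X]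
  {x₀ : X} {V : Type*} [NormedAddCommGroup V] [NormedSpace ℝ V]
  {ρ : Representation ℝ (FundamentalGroup X x₀) V}

/-- The pairing of two flat bundle-valued forms under the fibre metric does not depend on the lift to
the universal covering. -/
theorem FibreMetric.inner_form_eq (h : FibreMetric n ρ) {q : ℕ} {φ η : CoverForm n x₀ V q}
    (hφ : IsForm ρ φ) (hη : IsForm ρ η) {x : X} (p p' : PathClass x₀ x)
    (v v' : Fin q → TangentSpace (𝓡 n) x) :
    h.inner x p (φ x p v) (η x p v') = h.inner x p' (φ x p' v) (η x p' v') := by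
  rw [← deck_between p p', hφ.1, hη.1, h.equivariant]

theorem isForm_zero (q : ℕ) : IsForm ρ (0 : CoverForm n x₀ V q) := by
  refine ⟨fun x p γ v => by simp, fun i x p _ => ⟨fun _ => 0, contDiffAt_const, univ,
    Filter.univ_mem, fun y c _ => ?_⟩⟩
  ext v
  rfl

variable [IsManifold (𝓡 n) ∞ X]

/-- The pairing of two smooth forms, evaluated on coordinate vectors, is continuous. Near a given
point it is computed on the lifts obtained by continuing one chosen lift along short paths. -/
theorem FibreMetric.continuousOn_inner_form [PathConnectedSpace X] (h : FibreMetric n ρ) {q : ℕ}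
    {φ η : CoverForm n x₀ V q}
    (hφ : IsForm ρ φ) (hη : IsForm ρ η) (i : X) (I J : Fin q → Fin n)
    (p : ∀ x, PathClass x₀ x) :
    ContinuousOn (fun y =>
      h.inner ((extChartAt (𝓡 n) i).symm y) (p _)
        (φ ((extChartAt (𝓡 n) i).symm y) (p _) fun k => coordVec i y (I k))
        (η ((extChartAt (𝓡 n) i).symm y) (p _) fun k => coordVec i y (J k)))
      (extChartAt (𝓡 n) i).target := by
  intro y₀ hy₀
  refine ContinuousAt.continuousWithinAt ?_
  have : LocallyPathConnectedSpace X :=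
    ChartedSpace.locallyPathConnectedSpace (EuclideanSpace ℝ (Fin n)) X
  set x := (extChartAt (𝓡 n) i).symm y₀ with hx
  have hxs : x ∈ (extChartAt (𝓡 n) i).source := (extChartAt (𝓡 n) i).map_target hy₀
  have hxy : extChartAt (𝓡 n) i x = y₀ := (extChartAt (𝓡 n) i).right_inv hy₀
  obtain ⟨β, hβ, U, hU, hUβ⟩ := h.smooth i x (p x) hxs
  obtain ⟨α, hα, U₁, hU₁, hUα⟩ := hφ.2 i x (p x) hxs
  obtain ⟨α', hα', U₂, hU₂, hUα'⟩ := hη.2 i x (p x) hxs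
  rw [hxy] at hβ hα hα'
  obtain ⟨S, ⟨hS, hSc⟩, hSU⟩ := (LocallyPathConnectedSpace.path_connected_basis x).mem_iff.1
    (Filter.inter_mem hU (Filter.inter_mem hU₁ hU₂))
  have hlocal : ∀ y ∈ (extChartAt (𝓡 n) i).target, (extChartAt (𝓡 n) i).symm y ∈ S →
      h.inner ((extChartAt (𝓡 n) i).symm y) (p _)
        (φ ((extChartAt (𝓡 n) i).symm y) (p _) fun k => coordVec i y (I k))
        (η ((extChartAt (𝓡 n) i).symm y) (p _) fun k => coordVec i y (J k)) =
      β y (α y fun k => EuclideanSpace.single (I k) 1)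
        (α' y fun k => EuclideanSpace.single (J k) 1) := by
    intro y hy hyS
    obtain ⟨c, hc⟩ := hSc.joinedIn x (mem_of_mem_nhds hS) _ hyS
    have hrange : range c ⊆ U ∩ (U₁ ∩ U₂) := by
      rintro _ ⟨t, rfl⟩
      exact hSU (hc t)
    have hyy : extChartAt (𝓡 n) i ((extChartAt (𝓡 n) i).symm y) = y :=
      (extChartAt (𝓡 n) i).right_inv hy
    rw [h.inner_form_eq hφ hη (p _) ((p x).trans (.mk c)),
      hUβ _ c fun z hz => (hrange hz).1, hUα _ c fun z hz => (hrange hz).2.1,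
      hUα' _ c fun z hz => (hrange hz).2.2, hyy]
    unfold chartPull
    have hI : ∀ I : Fin q → Fin n, (⇑(mfderiv (𝓡 n) 𝓘(ℝ, EuclideanSpace ℝ (Fin n))
        (extChartAt (𝓡 n) i) ((extChartAt (𝓡 n) i).symm y)) ∘ fun k => coordVec i y (I k)) =
        fun k => EuclideanSpace.single (I k) (1 : ℝ) := fun I =>
      funext fun k => mfderiv_extChartAt_coordVec i hy (I k)
    exact congrArg₂ (fun a b => β y (α y a) (α' y b)) (hI I) (hI J)
  have hcont : ContinuousAt (fun y => β y (α y fun k => EuclideanSpace.single (I k) 1)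
      (α' y fun k => EuclideanSpace.single (J k) 1)) y₀ := by
    have h1 : ContinuousAt (fun y => α y fun k => EuclideanSpace.single (I k) (1 : ℝ)) y₀ :=
      (ContinuousAlternatingMap.apply ℝ (EuclideanSpace ℝ (Fin n)) V
        fun k => EuclideanSpace.single (I k) (1 : ℝ)).continuous.continuousAt.comp
        hα.continuousAt
    have h2 : ContinuousAt (fun y => α' y fun k => EuclideanSpace.single (J k) (1 : ℝ)) y₀ :=
      (ContinuousAlternatingMap.apply ℝ (EuclideanSpace ℝ (Fin n)) V
        fun k => EuclideanSpace.single (J k) (1 : ℝ)).continuous.continuousAt.comp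
        hα'.continuousAt
    exact (hβ.continuousAt.clm_apply h1).clm_apply h2
  refine hcont.congr ?_
  have hsymm : ContinuousAt (extChartAt (𝓡 n) i).symm y₀ :=
    (continuousOn_extChartAt_symm i).continuousAt
      ((isOpen_extChartAt_target i).mem_nhds hy₀)
  filter_upwards [(isOpen_extChartAt_target (I := 𝓡 n) i).mem_nhds hy₀,
    hsymm.preimage_mem_nhds hS] with y hy hyS
  exact (hlocal y hy hyS).symm

variable [PathConnectedSpace X]

/-- The pointwise inner product of two smooth forms is continuous in a chart. -/
theorem continuousOn_formInner (g : Metric n X) (h : FibreMetric n ρ) {q : ℕ}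
    {φ η : CoverForm n x₀ V q} (hφ : IsForm ρ φ) (hη : IsForm ρ η) (i : X) :
    ContinuousOn (formInner g h φ η i) (extChartAt (𝓡 n) i).target := by
  have hA : ContinuousOn (metricMatrix g i) (extChartAt (𝓡 n) i).target :=
    continuousOn_pi.2 fun k => continuousOn_pi.2 fun l => continuousOn_metricMatrix g i k l
  have hinv : ∀ k l, ContinuousOn (fun y => (metricMatrix g i y)⁻¹ k l)
      (extChartAt (𝓡 n) i).target := by
    intro k l
    have h1 : ContinuousOn (fun y => (metricMatrix g i y).det⁻¹ * (metricMatrix g i y).adjugate k l)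
        (extChartAt (𝓡 n) i).target := by
      refine ContinuousOn.mul (ContinuousOn.inv₀ ?_ fun y hy => det_metricMatrix_ne_zero g i hy) ?_
      · exact (continuous_id.matrix_det).comp_continuousOn hA
      · exact ((continuous_id.matrix_adjugate).matrix_elem k l).comp_continuousOn hA
    refine h1.congr fun y _ => ?_
    rw [Matrix.inv_def, Ring.inverse_eq_inv']
    rfl
  unfold formInner
  refine continuousOn_const.mul (continuousOn_finsetSum _ fun I _ =>
    continuousOn_finsetSum _ fun J _ => ?_)
  exact (continuousOn_finsetProd _ fun k _ => hinv _ _).mul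
    (h.continuousOn_inner_form hφ hη i I J fun x => .mk (PathConnectedSpace.somePath x₀ x))

theorem formInner_add_left (g : Metric n X) (h : FibreMetric n ρ) {q : ℕ}
    (φ φ' η : CoverForm n x₀ V q) (i : X) (y : EuclideanSpace ℝ (Fin n)) :
    formInner g h (φ + φ') η i y = formInner g h φ η i y + formInner g h φ' η i y := by
  simp only [formInner, Pi.add_apply, ContinuousAlternatingMap.add_apply, map_add,
    add_apply, mul_add, Finset.sum_add_distrib]

theorem formInner_smul_left (g : Metric n X) (h : FibreMetric n ρ) {q : ℕ} (c : ℝ)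
    (φ η : CoverForm n x₀ V q) (i : X) (y : EuclideanSpace ℝ (Fin n)) :
    formInner g h (c • φ) η i y = c * formInner g h φ η i y := by
  simp only [formInner, Pi.smul_apply, ContinuousAlternatingMap.smul_apply, map_smul,
    smul_apply, smul_eq_mul, Finset.mul_sum]
  refine Finset.sum_congr rfl fun I _ => Finset.sum_congr rfl fun J _ => ?_
  ring

theorem formInner_add_right (g : Metric n X) (h : FibreMetric n ρ) {q : ℕ}
    (φ η η' : CoverForm n x₀ V q) (i : X) (y : EuclideanSpace ℝ (Fin n)) :
    formInner g h φ (η + η') i y = formInner g h φ η i y + formInner g h φ η' i y := by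
  simp only [formInner, Pi.add_apply, ContinuousAlternatingMap.add_apply, map_add,
    mul_add, Finset.sum_add_distrib]

theorem formInner_smul_right (g : Metric n X) (h : FibreMetric n ρ) {q : ℕ} (c : ℝ)
    (φ η : CoverForm n x₀ V q) (i : X) (y : EuclideanSpace ℝ (Fin n)) :
    formInner g h φ (c • η) i y = c * formInner g h φ η i y := by
  simp only [formInner, Pi.smul_apply, ContinuousAlternatingMap.smul_apply, map_smul,
    smul_eq_mul, Finset.mul_sum]
  refine Finset.sum_congr rfl fun I _ => Finset.sum_congr rfl fun J _ => ?_
  ring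

variable [T2Space X] [CompactSpace X]

/-- The integrands of the `L²` inner product of smooth forms are continuous with compact support in
the chart domains, hence integrable. -/
theorem integrableOn_formInner (g : Metric n X) (h : FibreMetric n ρ) {q : ℕ}
    {φ η : CoverForm n x₀ V q} (hφ : IsForm ρ φ) (hη : IsForm ρ η) (i : X) :
    IntegrableOn (fun y => chartPartition n X i ((extChartAt (𝓡 n) i).symm y) *
      formInner g h φ η i y * √ (metricMatrix g i y).det) (extChartAt (𝓡 n) i).target := by
  have hA : ContinuousOn (metricMatrix g i) (extChartAt (𝓡 n) i).target :=
    continuousOn_pi.2 fun k => continuousOn_pi.2 fun l => continuousOn_metricMatrix g i k l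
  have hcont : ContinuousOn (fun y => chartPartition n X i ((extChartAt (𝓡 n) i).symm y) *
      formInner g h φ η i y * √ (metricMatrix g i y).det) (extChartAt (𝓡 n) i).target := by
    refine ((ContinuousOn.mul ?_ (continuousOn_formInner g h hφ hη i)).mul ?_)
    · exact (chartPartition n X i).contMDiff.continuous.comp_continuousOn
        (continuousOn_extChartAt_symm i)
    · exact (Real.continuous_sqrt.comp continuous_id.matrix_det).comp_continuousOn hA
  have hsub : tsupport (chartPartition n X i) ⊆ (extChartAt (𝓡 n) i).source := by
    rw [extChartAt_source]
    exact Classical.choose_spec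
      (SmoothPartitionOfUnity.exists_isSubordinate_chartAt_source (𝓡 n) X) i
  set S := extChartAt (𝓡 n) i '' tsupport (chartPartition n X i) with hS
  have hScomp : IsCompact S := (isClosed_tsupport _).isCompact.image_of_continuousOn
    ((continuousOn_extChartAt i).mono hsub)
  have hST : S ⊆ (extChartAt (𝓡 n) i).target := by
    rintro _ ⟨x, hx, rfl⟩
    exact (extChartAt (𝓡 n) i).map_source (hsub hx)
  refine ((hcont.mono hST).integrableOn_compact hScomp).of_forall_sdiff_eq_zero
    (isOpen_extChartAt_target i).measurableSet ?_
  rintro y ⟨hy, hyS⟩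
  have : chartPartition n X i ((extChartAt (𝓡 n) i).symm y) = 0 := by
    by_contra h0
    exact hyS ⟨_, subset_tsupport _ h0, (extChartAt (𝓡 n) i).right_inv hy⟩
  rw [this, zero_mul, zero_mul]

/-- Only finitely many charts contribute to the `L²` inner product. -/
theorem hasFiniteSupport_chartIntegral (g : Metric n X) (h : FibreMetric n ρ) {q : ℕ}
    (φ η : CoverForm n x₀ V q) :
    Function.HasFiniteSupport fun i : X => ∫ y in (extChartAt (𝓡 n) i).target,
      chartPartition n X i ((extChartAt (𝓡 n) i).symm y) * formInner g h φ η i y *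
        √ (metricMatrix g i y).det := by
  refine ((chartPartition n X).locallyFinite.finite_nonempty_of_compact).subset fun i hi => ?_
  by_contra hne
  rw [mem_ofPred_eq, not_nonempty_iff_eq_empty, Function.support_eq_empty_iff] at hne
  refine hi ?_
  simp [hne]

theorem L2Inner_add_left (g : Metric n X) (h : FibreMetric n ρ) {q : ℕ}
    {φ φ' η : CoverForm n x₀ V q} (hφ : IsForm ρ φ) (hφ' : IsForm ρ φ') (hη : IsForm ρ η) :
    L2Inner g h (φ + φ') η = L2Inner g h φ η + L2Inner g h φ' η := by
  unfold L2Inner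
  rw [← finsum_add_distrib (hasFiniteSupport_chartIntegral g h φ η)
    (hasFiniteSupport_chartIntegral g h φ' η)]
  refine finsum_congr fun i => ?_
  rw [← integral_add (integrableOn_formInner g h hφ hη i) (integrableOn_formInner g h hφ' hη i)]
  refine integral_congr_ae (Filter.Eventually.of_forall fun y => ?_)
  simp only [formInner_add_left]
  ring

theorem L2Inner_add_right (g : Metric n X) (h : FibreMetric n ρ) {q : ℕ}
    {φ η η' : CoverForm n x₀ V q} (hφ : IsForm ρ φ) (hη : IsForm ρ η) (hη' : IsForm ρ η') :
    L2Inner g h φ (η + η') = L2Inner g h φ η + L2Inner g h φ η' := by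
  unfold L2Inner
  rw [← finsum_add_distrib (hasFiniteSupport_chartIntegral g h φ η)
    (hasFiniteSupport_chartIntegral g h φ η')]
  refine finsum_congr fun i => ?_
  rw [← integral_add (integrableOn_formInner g h hφ hη i) (integrableOn_formInner g h hφ hη' i)]
  refine integral_congr_ae (Filter.Eventually.of_forall fun y => ?_)
  simp only [formInner_add_right]
  ring

theorem L2Inner_smul_left (g : Metric n X) (h : FibreMetric n ρ) {q : ℕ} (c : ℝ)
    (φ η : CoverForm n x₀ V q) : L2Inner g h (c • φ) η = c * L2Inner g h φ η := by
  unfold L2Inner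
  rw [← smul_eq_mul, smul_finsum]
  refine finsum_congr fun i => ?_
  rw [smul_eq_mul, ← integral_const_mul]
  refine integral_congr_ae (Filter.Eventually.of_forall fun y => ?_)
  simp only [formInner_smul_left]
  ring

theorem L2Inner_smul_right (g : Metric n X) (h : FibreMetric n ρ) {q : ℕ} (c : ℝ)
    (φ η : CoverForm n x₀ V q) : L2Inner g h φ (c • η) = c * L2Inner g h φ η := by
  unfold L2Inner
  rw [← smul_eq_mul, smul_finsum]
  refine finsum_congr fun i => ?_
  rw [smul_eq_mul, ← integral_const_mul]
  refine integral_congr_ae (Filter.Eventually.of_forall fun y => ?_)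
  simp only [formInner_smul_right]
  ring

theorem IsHarmonic.isForm {g : Metric n X} {h : FibreMetric n ρ} {q : ℕ}
    {φ : CoverForm n x₀ V q} (hφ : IsHarmonic g h φ) : IsForm ρ φ := by
  cases q with
  | zero => exact hφ.1
  | succ q => exact hφ.1

variable {ι : Type*} [LinearOrder ι] [Fintype ι]

/-- The value of `harmonicRep` is a smooth form in either case of its definition: it is a harmonic
form, or zero. -/
theorem isForm_harmonicRep (g : Metric n X) (h : FibreMetric n ρ) (K : SmoothTriangulation n X ι)
    (q : ℕ) (a : TwistedCoh K ρ q) : IsForm ρ (harmonicRep g h K q a) := by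
  unfold harmonicRep
  split_ifs with H
  · exact ((H.choose_spec a _).1 rfl).1.isForm
  · exact isForm_zero q

/-- The inner product on cohomology given by harmonic representatives, as a bilinear form. -/
noncomputable def cohBilinForm (g : Metric n X) (h : FibreMetric n ρ)
    (K : SmoothTriangulation n X ι) (q : ℕ) : LinearMap.BilinForm ℝ (TwistedCoh K ρ q) :=
  LinearMap.mk₂ ℝ (cohInner g h K q)
    (fun a a' b => by
      unfold cohInner
      rw [map_add]
      exact L2Inner_add_left g h (isForm_harmonicRep g h K q a) (isForm_harmonicRep g h K q a')
        (isForm_harmonicRep g h K q b))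
    (fun c a b => by
      unfold cohInner
      rw [map_smul]
      exact L2Inner_smul_left g h c _ _)
    (fun a b b' => by
      unfold cohInner
      rw [map_add]
      exact L2Inner_add_right g h (isForm_harmonicRep g h K q a) (isForm_harmonicRep g h K q b)
        (isForm_harmonicRep g h K q b'))
    (fun c a b => by
      unfold cohInner
      rw [map_smul]
      exact L2Inner_smul_right g h c _ _)

end FlatForms

/-! ### The Reidemeister torsion of a flat bundle -/

/-- The alternating product of the volumes `D ^ N q` of the integral cochains is a power of `D` with
exponent the negative of the Euler characteristic. -/
theorem prod_pow_zpow_eq (D : ℝ) (hD : D ≠ 0) (N : ℕ → ℕ) (m : ℕ) :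
    ∏ q ∈ Finset.range m, (D ^ N q) ^ ((-1 : ℤ) ^ (q + 1)) =
      D ^ (-∑ q ∈ Finset.range m, (-1 : ℤ) ^ q * (N q : ℤ)) := by
  induction m with
  | zero => simp
  | succ m ih =>
    rw [Finset.prod_range_succ, Finset.sum_range_succ, ih, ← zpow_natCast, ← zpow_mul,
      ← zpow_add₀ hD]
    congr 1
    rw [pow_succ]
    ring

end Reidemeister

theorem proposition2p3 {n : ℕ} {X : Type*} [TopologicalSpace X] [T2Space X] [CompactSpace X]
    [PathConnectedSpace X] [ChartedSpace (EuclideanSpace ℝ (Fin n)) X] [IsManifold (𝓡 n) ∞ X]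
    (g : Metric n X) (x₀ : X)
    {V : Type*} [NormedAddCommGroup V] [NormedSpace ℝ V] [FiniteDimensional ℝ V]
    (ρ : Representation ℝ (FundamentalGroup X x₀) V)
    (hρ : ∀ γ, |LinearMap.det (ρ γ)| = 1)
    (M : Submodule ℤ V) [DiscreteTopology M] [IsZLattice ℝ M]
    (hM : ∀ γ, ∀ m ∈ M, ρ γ m ∈ M)
    (h : FibreMetric n ρ)
    {ι : Type*} [LinearOrder ι] [Fintype ι] (K : SmoothTriangulation n X ι)
    (w : ∀ (q : ℕ) (s : Simplex K.complex q), PathClass x₀ (K.vert s))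
    {κ : Type*} [Fintype κ] [DecidableEq κ] (θ : Module.Basis κ ℝ V)
    (hθ : (∃ b : Module.Basis κ ℤ M, |θ.det (fun k => (b k : V))| = 1) ∨ K.eulerChar = 0)
    {r : ℕ → ℕ} (e : ∀ q, Module.Basis (Fin (r q)) ℤ (CohFree K ρ M hM q)) :
    reidemeisterTorsion g h K θ w =
      regulator g h K M hM e *
        ∏ q ∈ Finset.range (n + 1),
          (Nat.card (cohTors K ρ M hM q) : ℝ) ^ ((-1 : ℤ) ^ (q + 1)) := by
  classical
  -- a `ℤ`-basis of `M` indexed like `θ`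
  obtain ⟨b, hb⟩ : ∃ b : Module.Basis κ ℤ M,
      |θ.det (fun k => (b k : V))| = 1 ∨ K.eulerChar = 0 := by
    rcases hθ with ⟨b, hb⟩ | hχ
    · exact ⟨b, Or.inl hb⟩
    · have := ZLattice.module_free ℝ M
      let b₀ := Module.Free.chooseBasis ℤ M
      exact ⟨b₀.reindex ((b₀.ofZLatticeBasis ℝ M).indexEquiv θ), Or.inr hχ⟩
  let θ' : Module.Basis κ ℝ V := b.ofZLatticeBasis ℝ M
  have hθ' : ∀ k, θ' k = b k := fun k => b.ofZLatticeBasis_apply ℝ M k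
  -- the product over `q ≤ n` exhausts the complex
  have hempty : IsEmpty (Simplex K.complex (n + 1)) :=
    ⟨fun s => absurd (K.le_of_simplex s) (by omega)⟩
  have hn : Subsingleton (Cochain K ρ (n + 1)) := inferInstance
  have key := torsion_eq_of_lattice (dL := coboundary K (latticeRep ρ M hM))
    (dC := coboundary K ρ) (f := cochainIncl K ρ M hM) n hn
    (coboundary_coboundary K (latticeRep ρ M hM)) (coboundary_coboundary K ρ)
    (cochainIncl_d K ρ M hM) (latticeCochainBasis K ρ M hM b w) (cochainBasis K ρ θ' w)
    (cochainIncl_latticeCochainBasis K ρ M hM b θ' hθ' w) (cochainBasis K ρ θ w)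
    (fun q => |θ.det θ'| ^ Nat.card (Simplex K.complex q))
    (fun q _ => relVol_cochainBasis K ρ θ θ' w q)
    (fun q => (cohFreeIncl K ρ M hM q).toAddMonoidHom) (fun q z => rfl) e (cohBilinForm g h K)
  -- the integral bases have volume one, up to a power that vanishes with the Euler characteristic
  have hδ : ∏ q ∈ Finset.range (n + 1),
      (|θ.det θ'| ^ Nat.card (Simplex K.complex q)) ^ ((-1 : ℤ) ^ (q + 1)) = 1 := by
    have hD : |θ.det θ'| ≠ 0 := abs_ne_zero.2 (θ.isUnit_det θ').ne_zero
    rw [prod_pow_zpow_eq _ hD]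
    rcases hb with hb | hχ
    · have : (θ' : κ → V) = fun k => (b k : V) := funext hθ'
      rw [this, hb, one_zpow]
    · have : ∑ q ∈ Finset.range (n + 1), (-1 : ℤ) ^ q * (Nat.card (Simplex K.complex q) : ℤ) = 0 :=
        hχ
      rw [this, neg_zero, zpow_zero]
  rw [hδ, one_mul] at key
  exact key
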